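/- Let $M$ be a smooth manifold of dimension $n\ge 3$ and let $F\colon TM\to\mathbb R$ be a Finsler metric: $F$ is continuous, smooth on the complement of the zero section, $F(tv)=tF(v)$ for all $t>0$, and, in induced coordinates $(x^i,y^i)$ of $TM$, the Hessian $g_{ij}=\partial^2E/\partial y^i\partial y^j$ of the energy $E=\tfrac12F^2$ is positive definite at all nonzero vectors. Let $(g^{ij})$ be the inverse of $(g_{ij})$, let $$G^l=\tfrac12\,g^{lm}\Big(y^k\frac{\partial^2E}{\partial y^m\partial x^k}-\frac{\partial E}{\partial x^m}\Big)$$ be the geodesic spray coefficients, and let $$P^l_{ijk}=-\frac{\partial^3G^l}{\partial y^i\partial y^j\partial y^k}$$ be the mixed curvature tensor of the Berwald connection. Let $\alpha\colon M\to\mathbb R$ be a smooth function with $d_p\alpha\ne0$ at a point $p\in M$, write $\alpha_l=\partial\alpha/\partial x^l$, and let $\tilde P^l_{ijk}$ be the mixed curvature tensor of the conformally changed metric $\tilde F=e^{\alpha}F$. Suppose that 1. all sectional curvatures of the indicatrix hypersurface $\{v\in T_pM : F(v)=1\}$, with the Riemannian metric induced by $g_{ij}$ on $T_pM\setminus\{0\}$,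 are positive; 2. $\tilde P^l_{ijk}\alpha_l=P^l_{ijk}\alpha_l$ at every nonzero $v\in T_pM$, for all $i,j,k$ (summation over $l$). Put $X^l=g^{lm}\alpha_m$ and $X^l_s=\partial X^l/\partial y^s$. Then at every nonzero $v\in T_pM$ the Gram determinant, with respect to $g_{ij}$, of the vector fields $$X^l\frac{\partial}{\partial y^l}-\frac{y^m\alpha_m}{2E}\,y^l\frac{\partial}{\partial y^l}\qquad\text{and}\qquad X^sX^l_s\,\frac{\partial}{\partial y^l}$$ is zero, and these two vector fields are linearly dependent there. -/

import Mathlib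

open scoped Manifold ContDiff

namespace FinslerConformal

noncomputable section

/-- The partial derivative `∂f/∂uⁱ` at `u`. -/
def pd {n : ℕ} (i : Fin n) (f : EuclideanSpace ℝ (Fin n) → ℝ) (u : EuclideanSpace ℝ (Fin n)) : ℝ :=
  fderiv ℝ f u (EuclideanSpace.single i 1)

/-! ### Riemannian metrics in coordinates -/

/-- The Christoffel symbol `Γᵏᵢⱼ` of the Levi-Civita connection of the metric `h` on an open part
of `ℝᵐ`. -/
def christoffel {m : ℕ} (h : EuclideanSpace ℝ (Fin m) → Matrix (Fin m) (Fin m) ℝ)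
    (k i j : Fin m) (z : EuclideanSpace ℝ (Fin m)) : ℝ :=
  1 / 2 * ∑ l, (h z)⁻¹ k l *
    (pd i (fun w => h w j l) z + pd j (fun w => h w i l) z - pd l (fun w => h w i j) z)

/-- The component `Rˡₖᵢⱼ` of the Riemann curvature tensor:
`R(∂ᵢ, ∂ⱼ)∂ₖ = ∇ᵢ∇ⱼ∂ₖ - ∇ⱼ∇ᵢ∂ₖ = ∑ₗ Rˡₖᵢⱼ ∂ₗ`. -/
def riemann {m : ℕ} (h : EuclideanSpace ℝ (Fin m) → Matrix (Fin m) (Fin m) ℝ)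
    (l k i j : Fin m) (z : EuclideanSpace ℝ (Fin m)) : ℝ :=
  pd i (christoffel h l j k) z - pd j (christoffel h l i k) z
    + ∑ s, (christoffel h l i s z * christoffel h s j k z
      - christoffel h l j s z * christoffel h s i k z)

/-- The inner product of two vectors, given by their components, with respect to the Gram
matrix `g` of a basis. -/
def inner2 {m : ℕ} (g : Matrix (Fin m) (Fin m) ℝ) (a b : Fin m → ℝ) : ℝ :=
  ∑ i, ∑ j, g i j * a i * b j

/-- The Gram determinant of two vectors with respect to `g`. -/
def gramDet {m : ℕ} (g : Matrix (Fin m) (Fin m) ℝ) (a b : Fin m → ℝ) : ℝ :=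
  Matrix.det !![inner2 g a a, inner2 g a b; inner2 g b a, inner2 g b b]

/-- The sectional curvature `h(R(a, b)b, a) / (h(a, a) h(b, b) - h(a, b)²)` at `z` of the plane
spanned by `a` and `b`. -/
def sectionalCurvature {m : ℕ} (h : EuclideanSpace ℝ (Fin m) → Matrix (Fin m) (Fin m) ℝ)
    (z : EuclideanSpace ℝ (Fin m)) (a b : Fin m → ℝ) : ℝ :=
  inner2 (h z) (fun l => ∑ k, ∑ i, ∑ j, riemann h l k i j z * b k * a i * b j) a
    / gramDet (h z) a b

/-! ### Finsler quantities in induced coordinates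

Below `L x y` is a Finslerian metric function written in the coordinates `x¹, …, xⁿ, y¹, …, yⁿ` of
the tangent bundle that are induced by local coordinates of the base. -/

/-- The energy `E = F² / 2`. -/
def energy {n : ℕ} (L : EuclideanSpace ℝ (Fin n) → EuclideanSpace ℝ (Fin n) → ℝ)
    (x y : EuclideanSpace ℝ (Fin n)) : ℝ :=
  1 / 2 * L x y ^ 2

/-- The Riemann-Finsler metric `gᵢⱼ = ∂²E/∂yⁱ∂yʲ`. -/
def metric {n : ℕ} (L : EuclideanSpace ℝ (Fin n) → EuclideanSpace ℝ (Fin n) → ℝ)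
    (x y : EuclideanSpace ℝ (Fin n)) : Matrix (Fin n) (Fin n) ℝ :=
  Matrix.of fun i j => pd i (pd j (energy L x)) y

/-- The geodesic spray coefficient
`Gˡ = (1/2) gˡᵐ (yᵏ ∂²E/∂yᵐ∂xᵏ - ∂E/∂xᵐ)`. -/
def spray {n : ℕ} (L : EuclideanSpace ℝ (Fin n) → EuclideanSpace ℝ (Fin n) → ℝ)
    (l : Fin n) (x y : EuclideanSpace ℝ (Fin n)) : ℝ :=
  1 / 2 * ∑ m, (metric L x y)⁻¹ l m *
    ((∑ k, y k * pd m (fun y' => pd k (fun x' => energy L x' y') x) y)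
      - pd m (fun x' => energy L x' y) x)

/-- The mixed curvature `Pˡᵢⱼₖ = -∂³Gˡ/∂yᵏ∂yʲ∂yⁱ` of the Berwald connection. -/
def mixedCurvature {n : ℕ} (L : EuclideanSpace ℝ (Fin n) → EuclideanSpace ℝ (Fin n) → ℝ)
    (l i j k : Fin n) (x y : EuclideanSpace ℝ (Fin n)) : ℝ :=
  -pd k (pd j (pd i (spray L l x))) y

/-- The component `Xˡ = gˡᵐ αₘ` of the Finslerian gradient of a function `a` of the position. -/
def grad {n : ℕ} (L : EuclideanSpace ℝ (Fin n) → EuclideanSpace ℝ (Fin n) → ℝ)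
    (a : EuclideanSpace ℝ (Fin n) → ℝ) (l : Fin n) (x y : EuclideanSpace ℝ (Fin n)) : ℝ :=
  ∑ m, (metric L x y)⁻¹ l m * pd m a x

/-- The components `Xˡ - (yᵐαₘ / 2E) yˡ` of the projected Finslerian gradient. -/
def projGrad {n : ℕ} (L : EuclideanSpace ℝ (Fin n) → EuclideanSpace ℝ (Fin n) → ℝ)
    (a : EuclideanSpace ℝ (Fin n) → ℝ) (x y : EuclideanSpace ℝ (Fin n)) : Fin n → ℝ :=
  fun l => grad L a l x y - (∑ m, y m * pd m a x) / (2 * energy L x y) * y l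

/-- The components `Xˢ Xˡₛ`, where `Xˡₛ = ∂Xˡ/∂yˢ`. -/
def gradDerivGrad {n : ℕ} (L : EuclideanSpace ℝ (Fin n) → EuclideanSpace ℝ (Fin n) → ℝ)
    (a : EuclideanSpace ℝ (Fin n) → ℝ) (x y : EuclideanSpace ℝ (Fin n)) : Fin n → ℝ :=
  fun l => ∑ s, grad L a s x y * pd s (grad L a l x) y

/-! ### The indicatrix -/

/-- `σ` restricted to `U` is a regular local parametrization of the indicatrix hypersurface
`{y | L x y = 1}` of the tangent space at the point with coordinates `x`. -/
structure IsIndicatrixParam {n : ℕ}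
    (L : EuclideanSpace ℝ (Fin n) → EuclideanSpace ℝ (Fin n) → ℝ) (x : EuclideanSpace ℝ (Fin n))
    (U : Set (EuclideanSpace ℝ (Fin (n - 1))))
    (σ : EuclideanSpace ℝ (Fin (n - 1)) → EuclideanSpace ℝ (Fin n)) : Prop where
  isOpen : IsOpen U
  smooth : ContDiffOn ℝ ∞ σ U
  immersive : ∀ z ∈ U, Function.Injective (fderiv ℝ σ z)
  mem_indicatrix : ∀ z ∈ U, L x (σ z) = 1

/-- The Riemannian metric induced on the indicatrix by the Riemann-Finsler metric, in the
parametrization `σ`. -/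
def inducedMetric {n : ℕ}
    (L : EuclideanSpace ℝ (Fin n) → EuclideanSpace ℝ (Fin n) → ℝ) (x : EuclideanSpace ℝ (Fin n))
    (σ : EuclideanSpace ℝ (Fin (n - 1)) → EuclideanSpace ℝ (Fin n))
    (z : EuclideanSpace ℝ (Fin (n - 1))) : Matrix (Fin (n - 1)) (Fin (n - 1)) ℝ :=
  Matrix.of fun a b =>
    inner2 (metric L x (σ z)) (fun i => pd a (fun w => σ w i) z) (fun i => pd b (fun w => σ w i) z)

/-- All sectional curvatures of the indicatrix hypersurface, as a Riemannian submanifold of the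
punctured tangent space with the Riemann-Finsler metric, are positive. -/
def IndicatrixPosCurved {n : ℕ}
    (L : EuclideanSpace ℝ (Fin n) → EuclideanSpace ℝ (Fin n) → ℝ)
    (x : EuclideanSpace ℝ (Fin n)) : Prop :=
  ∀ (U : Set (EuclideanSpace ℝ (Fin (n - 1))))
    (σ : EuclideanSpace ℝ (Fin (n - 1)) → EuclideanSpace ℝ (Fin n)),
    IsIndicatrixParam L x U σ → ∀ z ∈ U, ∀ a b : Fin (n - 1) → ℝ,
      LinearIndependent ℝ ![a, b] → 0 < sectionalCurvature (inducedMetric L x σ) z a b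

/-! ### Finsler metrics on manifolds -/

/-- The expression of a function `F` on the tangent bundle in the coordinates induced by the
chart `e`: the pair `(x, y)` stands for the vector `∑ᵢ yⁱ ∂/∂uⁱ` at the point with coordinates
`x`. -/
def inChart {n : ℕ} {M : Type*} [TopologicalSpace M] [ChartedSpace (EuclideanSpace ℝ (Fin n)) M]
    (F : TangentBundle (𝓡 n) M → ℝ) (e : OpenPartialHomeomorph M (EuclideanSpace ℝ (Fin n)))
    (x y : EuclideanSpace ℝ (Fin n)) : ℝ :=
  F ⟨e.symm x, mfderiv (𝓡 n) (𝓡 n) e.symm x y⟩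

/-- `F` is a Finsler metric (Finslerian metric function) on the `n`-manifold `M`. -/
structure IsFinslerMetric {n : ℕ} {M : Type*} [TopologicalSpace M]
    [ChartedSpace (EuclideanSpace ℝ (Fin n)) M] [IsManifold (𝓡 n) ∞ M]
    (F : TangentBundle (𝓡 n) M → ℝ) : Prop where
  continuous : Continuous F
  smooth : ContMDiffOn (𝓡 n).tangent 𝓘(ℝ, ℝ) ∞ F {v | v.2 ≠ 0}
  homogeneous : ∀ (p : M) (v : TangentSpace (𝓡 n) p) (t : ℝ), 0 < t → F ⟨p, t • v⟩ = t * F ⟨p, v⟩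
  posDef : ∀ e ∈ IsManifold.maximalAtlas (𝓡 n) ∞ M, ∀ x ∈ e.target,
    ∀ y : EuclideanSpace ℝ (Fin n), y ≠ 0 → (metric (inChart F e) x y).PosDef

/-- The conformal change `e^α F`. -/
def conformalChange {n : ℕ} {M : Type*} [TopologicalSpace M]
    [ChartedSpace (EuclideanSpace ℝ (Fin n)) M]
    (α : M → ℝ) (F : TangentBundle (𝓡 n) M → ℝ) : TangentBundle (𝓡 n) M → ℝ :=
  fun v => Real.exp (α v.proj) * F v

end

end FinslerConformal

open FinslerConformal

namespace FinslerConformal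

open Filter Topology Set

/-! ### Homogeneous functions -/

section Homogeneous

variable {V W : Type*} [NormedAddCommGroup V] [NormedSpace ℝ V]
  [NormedAddCommGroup W] [NormedSpace ℝ W]

/-! Fix the tangent space at the point, with energy E, covector α = dα and gradient X of α. The
conformal change adds (yᵐαₘ)yˡ − E Xˡ to the spray (`IsFinslerAt.spray_conformal`). Contracting with
α and differentiating three times, the invariance of the mixed curvature says that the third
derivatives of E|X|² vanish, so 2E|X|² = q(y, y) for a symmetric bilinear form q
(`exists_quadratic_of_pd₃_eq_zero`). Since XˢXˡₛ is the gradient of |X|²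
(`IsFinslerAt.gradDerivGrad_eq`), everything reduces to showing that q(y, ·) lies in the span of α
and dE(y) (`HasQuadraticGradient.exists_eq_combination`). Euler's relation for |X|², of degree 0,
then forces d|X|² to be a multiple of α − (α(y)/2E) dE, whose gradient is the projected gradient.

By Cauchy-Schwarz the form B = q − α⊗α is positive semidefinite, with the poles (the vectors where
dE = ±α) in its radical. The Legendre transform y ↦ dE(y) is a diffeomorphism off the origin, so
each m ≠ 0 with α(m) = 0 gives a closed smooth curve y(φ) with dE(y(φ)) = cos φ α + sin φ q(m, ·).
Along it the function −cot φ + q(m, m) α(y)/q(m, y) has derivative (q(m, y)² − q(m, m) B(y, y)) /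
(sin²φ q(m, y)²), which is nonpositive by Cauchy-Schwarz for B. The singularities at the two poles
are removable, because the curve is smooth there. A function that is nonincreasing on both
half-turns and returns to its starting value is constant, so equality holds in Cauchy-Schwarz
(`HasQuadraticGradient.cauchySchwarz_eq_curve`). Hence B(y, ·) is proportional to B(m, ·) = q(m, ·),
which lies in the span of α and dE(y). -/

theorem fderiv_apply_self_of_homogeneous {h : V → W} {k : ℕ} {y : V}
    (hh : ∀ t : ℝ, 0 < t → h (t • y) = t ^ k • h y) (hd : DifferentiableAt ℝ h y) :
    fderiv ℝ h y y = (k : ℝ) • h y := by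
  have h1 : HasDerivAt (fun t : ℝ => h (t • y)) (fderiv ℝ h y y) 1 := by
    have h2 : HasDerivAt (fun t : ℝ => t • y) y 1 := by
      simpa using (hasDerivAt_id (1 : ℝ)).smul_const y
    have h3 : HasFDerivAt h (fderiv ℝ h y) ((1 : ℝ) • y) := by
      simpa using hd.hasFDerivAt
    exact h3.comp_hasDerivAt (1 : ℝ) h2
  have h4 : HasDerivAt (fun t : ℝ => t ^ k • h y) ((k : ℝ) • h y) 1 := by
    simpa using (hasDerivAt_pow k (1 : ℝ)).smul_const (h y)
  refine h1.unique (h4.congr_of_eventuallyEq ?_)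
  filter_upwards [lt_mem_nhds (zero_lt_one : (0 : ℝ) < 1)] with t ht using hh t ht

theorem fderiv_smul_of_homogeneous {h : V → W} {k : ℕ}
    (hh : ∀ (y : V) (t : ℝ), 0 < t → h (t • y) = t ^ (k + 1) • h y) (y : V) {t : ℝ} (ht : 0 < t) :
    fderiv ℝ h (t • y) = t ^ k • fderiv ℝ h y := by
  have h1 : fderiv ℝ (h <| t • ·) y = t ^ (k + 1) • fderiv ℝ h y := by
    have : (h <| t • ·) = t ^ (k + 1) • h := by
      ext z; exact hh z t ht
    rw [this]
    have : Invertible (t ^ (k + 1)) := invertibleOfNonzero (by positivity)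
    exact fderiv_const_smul_of_invertible _
  rw [fderiv_comp_smul, pow_succ', mul_smul] at h1
  exact smul_right_injective _ ht.ne' h1

end Homogeneous

/-! ### Minkowski energies and their Legendre transform -/

/-- `E` is the energy of a Minkowski norm: positively homogeneous of degree two, and smooth with
positive definite Hessian away from the origin. -/
structure IsMinkowskiEnergy {V : Type*} [NormedAddCommGroup V] [NormedSpace ℝ V] (E : V → ℝ) :
    Prop where
  smooth : ∀ y, y ≠ 0 → ContDiffAt ℝ ∞ E y
  homogeneous : ∀ (y : V) (t : ℝ), 0 < t → E (t • y) = t ^ 2 * E y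
  hess_pos : ∀ y, y ≠ 0 → ∀ v, v ≠ 0 → 0 < fderiv ℝ (fderiv ℝ E) y v v

namespace IsMinkowskiEnergy

variable {V : Type*} [NormedAddCommGroup V] [NormedSpace ℝ V] {E : V → ℝ}

theorem fderiv_smooth (hE : IsMinkowskiEnergy E) {y : V} (hy : y ≠ 0) :
    ContDiffAt ℝ ∞ (fderiv ℝ E) y :=
  (hE.smooth y hy).fderiv_right (by simp)

theorem fderiv_apply_self (hE : IsMinkowskiEnergy E) {y : V} (hy : y ≠ 0) :
    fderiv ℝ E y y = 2 * E y := by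
  simpa using fderiv_apply_self_of_homogeneous (k := 2) (hE.homogeneous y)
    ((hE.smooth y hy).differentiableAt (by simp))

theorem fderiv_smul (hE : IsMinkowskiEnergy E) (y : V) {t : ℝ} (ht : 0 < t) :
    fderiv ℝ E (t • y) = t • fderiv ℝ E y := by
  simpa using fderiv_smul_of_homogeneous (k := 1) hE.homogeneous y ht

theorem hess_self (hE : IsMinkowskiEnergy E) {y : V} (hy : y ≠ 0) :
    fderiv ℝ (fderiv ℝ E) y y = fderiv ℝ E y := by
  simpa using fderiv_apply_self_of_homogeneous (k := 1) (h := fderiv ℝ E) (y := y)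
    (fun t ht => by simpa using hE.fderiv_smul y ht)
    ((hE.fderiv_smooth hy).differentiableAt (by simp))

theorem hess_smul (hE : IsMinkowskiEnergy E) (y : V) {t : ℝ} (ht : 0 < t) :
    fderiv ℝ (fderiv ℝ E) (t • y) = fderiv ℝ (fderiv ℝ E) y := by
  simpa using fderiv_smul_of_homogeneous (k := 0) (h := fderiv ℝ E)
    (fun y t ht => by simpa using hE.fderiv_smul y ht) y ht

theorem hess_symm (hE : IsMinkowskiEnergy E) {y : V} (hy : y ≠ 0) (v w : V) :
    fderiv ℝ (fderiv ℝ E) y v w = fderiv ℝ (fderiv ℝ E) y w v :=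
  (hE.smooth y hy).isSymmSndFDerivAt (by simpa using ENat.LEInfty.out) v w

theorem hess_apply_self (hE : IsMinkowskiEnergy E) {y : V} (hy : y ≠ 0) (v : V) :
    fderiv ℝ (fderiv ℝ E) y v y = fderiv ℝ E y v := by
  rw [hE.hess_symm hy, hE.hess_self hy]

theorem pos (hE : IsMinkowskiEnergy E) {y : V} (hy : y ≠ 0) : 0 < E y := by
  have h := hE.hess_pos y hy y hy
  rw [hE.hess_self hy, hE.fderiv_apply_self hy] at h
  linarith

theorem fderiv_ne_zero (hE : IsMinkowskiEnergy E) {y : V} (hy : y ≠ 0) : fderiv ℝ E y ≠ 0 := by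
  intro h
  have := hE.fderiv_apply_self hy
  rw [h] at this
  have := hE.pos hy
  simp at *
  linarith

/-- Positivity of the Hessian integrates to strict monotonicity along the segment from y₁ to y₂. A
segment through the origin, where E need not be smooth, is treated by homogeneity. -/
theorem fderiv_strictMono (hE : IsMinkowskiEnergy E) {y₁ y₂ : V} (h₁ : y₁ ≠ 0) (h₂ : y₂ ≠ 0)
    (h : y₁ ≠ y₂) : 0 < (fderiv ℝ E y₂ - fderiv ℝ E y₁) (y₂ - y₁) := by
  by_cases h0 : ∀ τ : ℝ, τ ∈ Icc (0 : ℝ) 1 → y₁ + τ • (y₂ - y₁) ≠ 0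
  · set w := y₂ - y₁ with hw
    have hw0 : w ≠ 0 := sub_ne_zero.2 h.symm
    have hd : ∀ τ ∈ Icc (0 : ℝ) 1, HasDerivAt (fun τ : ℝ => fderiv ℝ E (y₁ + τ • w) w)
        (fderiv ℝ (fderiv ℝ E) (y₁ + τ • w) w w) τ := by
      intro τ hτ
      have h2 : HasDerivAt (fun t : ℝ => y₁ + t • w) w τ := by
        simpa using ((hasDerivAt_id τ).smul_const w).const_add y₁
      have h3 := ((hE.fderiv_smooth (h0 τ hτ)).differentiableAt (by simp)).hasFDerivAt
      have h4 := h3.comp_hasDerivAt τ h2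
      simpa using h4.clm_apply (hasDerivAt_const τ w)
    have hm : StrictMonoOn (fun τ : ℝ => fderiv ℝ E (y₁ + τ • w) w) (Icc 0 1) := by
      apply strictMonoOn_of_deriv_pos (convex_Icc 0 1)
      · exact fun τ hτ => (hd τ hτ).continuousAt.continuousWithinAt
      · intro τ hτ
        have hτ' := interior_subset hτ
        rw [(hd τ hτ').deriv]
        exact hE.hess_pos _ (h0 τ hτ') w hw0
    have := hm (left_mem_Icc.2 zero_le_one) (right_mem_Icc.2 zero_le_one) zero_lt_one
    simp only [zero_smul, add_zero, one_smul] at this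
    have h5 : y₁ + w = y₂ := by rw [hw]; abel
    rw [h5] at this
    rw [sub_apply]
    linarith
  -- Here y₁ and y₂ point in opposite directions, and Euler's relation makes both cross terms
  -- dE(y₁)(y₂) and dE(y₂)(y₁) negative.
  · push Not at h0
    obtain ⟨τ, ⟨hτ0, hτ1⟩, hτ⟩ := h0
    have e1 : (1 - τ) • y₁ = -(τ • y₂) := by
      have : (1 - τ) • y₁ + τ • y₂ = y₁ + τ • (y₂ - y₁) := by module
      rw [hτ] at this
      exact eq_neg_of_add_eq_zero_left this
    have hτ0' : 0 < τ := by
      rcases hτ0.eq_or_lt with h | h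
      · subst h; simp at e1; exact absurd e1 h₁
      · exact h
    have hτ1' : τ < 1 := by
      rcases hτ1.eq_or_lt with h | h
      · subst h; simp at e1; exact absurd e1 h₂
      · exact h
    have a1 : τ * fderiv ℝ E y₁ y₂ = -((1 - τ) * (2 * E y₁)) := by
      have := congrArg (fderiv ℝ E y₁) e1
      simp only [map_smul, map_neg, smul_eq_mul, hE.fderiv_apply_self h₁] at this
      linarith
    have a2 : (1 - τ) * fderiv ℝ E y₂ y₁ = -(τ * (2 * E y₂)) := by
      have := congrArg (fderiv ℝ E y₂) e1
      simp only [map_smul, map_neg, smul_eq_mul, hE.fderiv_apply_self h₂] at this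
      linarith
    have p1 := hE.pos h₁
    have p2 := hE.pos h₂
    have b1 : fderiv ℝ E y₁ y₂ < 0 := by
      by_contra hcon
      push Not at hcon
      have := mul_nonneg hτ0 hcon
      have : 0 < (1 - τ) * (2 * E y₁) := mul_pos (by linarith) (by linarith)
      linarith
    have b2 : fderiv ℝ E y₂ y₁ < 0 := by
      by_contra hcon
      push Not at hcon
      have := mul_nonneg (by linarith : 0 ≤ 1 - τ) hcon
      have : 0 < τ * (2 * E y₂) := mul_pos hτ0' (by linarith)
      linarith
    simp only [sub_apply, map_sub, hE.fderiv_apply_self h₁,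
      hE.fderiv_apply_self h₂]
    linarith

theorem fderiv_injective (hE : IsMinkowskiEnergy E) {y₁ y₂ : V} (h₁ : y₁ ≠ 0) (h₂ : y₂ ≠ 0)
    (h : fderiv ℝ E y₁ = fderiv ℝ E y₂) : y₁ = y₂ := by
  by_contra hne
  have := hE.fderiv_strictMono h₁ h₂ hne
  rw [h] at this
  simp at this

/-- The Cauchy-Schwarz inequality for the Hessian of `E`, applied to the position vector. -/
theorem sq_le_of_hess_eq (hE : IsMinkowskiEnergy E) {y : V} (hy : y ≠ 0) {α : V →L[ℝ] ℝ} {X : V}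
    (hX : fderiv ℝ (fderiv ℝ E) y X = α) : α y ^ 2 ≤ 2 * E y * α X := by
  set g := fderiv ℝ (fderiv ℝ E) y with hg
  have hnn : ∀ v, 0 ≤ g v v := by
    intro v
    rcases eq_or_ne v 0 with rfl | hv
    · simp
    · exact (hE.hess_pos y hy v hv).le
  have h1 : g X y = α y := by rw [hX]
  have h2 : g y X = α y := by rw [hg, hE.hess_symm hy, ← hg, h1]
  have h3 : g y y = 2 * E y := by rw [hg, hE.hess_self hy, hE.fderiv_apply_self hy]
  have h4 : g X X = α X := by rw [hX]
  have h5 := hnn ((2 * E y) • X - α y • y)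
  simp only [map_sub, map_smul, sub_apply, smul_apply,
    smul_eq_mul, h1, h2, h3, h4] at h5
  have hp := hE.pos hy
  have h6 : 0 ≤ (2 * E y) * (2 * E y * α X - α y ^ 2) := by nlinarith
  have := nonneg_of_mul_nonneg_right h6 (by linarith)
  linarith

variable [FiniteDimensional ℝ V]

/-- A maximum of θ²/E on the half space θ > 0 is a point where dE is proportional to θ, and
rescaling adjusts the factor. -/
theorem fderiv_surjective (hE : IsMinkowskiEnergy E) {θ : V →L[ℝ] ℝ} (hθ : θ ≠ 0) :
    ∃ y, y ≠ 0 ∧ fderiv ℝ E y = θ := by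
  obtain ⟨v, hv⟩ : ∃ v, 0 < θ v := by
    obtain ⟨v, hv⟩ : ∃ v, θ v ≠ 0 := by
      by_contra h
      push Not at h
      exact hθ (ContinuousLinearMap.ext h)
    rcases hv.lt_or_gt with h | h
    · exact ⟨-v, by simpa using h⟩
    · exact ⟨v, h⟩
  have hv0 : v ≠ 0 := by rintro rfl; simp at hv
  -- Writing θ|θ| instead of θ² keeps the sign, so the maximum over the whole sphere is attained
  -- where θ > 0. Degree 0 makes it a maximum over all nonzero vectors.
  set G : V → ℝ := fun y => θ y * |θ y| / E y with hG
  have hGhom : ∀ (y : V) (t : ℝ), 0 < t → G (t • y) = G y := by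
    intro y t ht
    simp only [hG, map_smul, smul_eq_mul, abs_mul, abs_of_pos ht, hE.homogeneous y t ht]
    rw [show t * θ y * (t * |θ y|) = t ^ 2 * (θ y * |θ y|) by ring,
      mul_div_mul_left _ _ (by positivity)]
  have hne : ∀ y ∈ Metric.sphere (0 : V) 1, y ≠ 0 := by
    rintro y hy rfl; simp at hy
  have hunit : ∀ y : V, y ≠ 0 → ‖y‖⁻¹ • y ∈ Metric.sphere (0 : V) 1 := by
    intro y hy
    simp [norm_smul, inv_mul_cancel₀ (norm_ne_zero_iff.2 hy)]
  have hcont : ContinuousOn G (Metric.sphere (0 : V) 1) := by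
    intro y hy
    have h1 : ContinuousAt E y := (hE.smooth y (hne y hy)).continuousAt
    have h2 : ContinuousAt (fun y => θ y * |θ y|) y := by fun_prop
    exact (h2.div h1 (hE.pos (hne y hy)).ne').continuousWithinAt
  obtain ⟨y, hyS, hmax⟩ := (isCompact_sphere (0 : V) 1).exists_isMaxOn
    ⟨_, hunit v hv0⟩ hcont
  have hy0 := hne y hyS
  have hle : ∀ z, z ≠ 0 → G z ≤ G y := by
    intro z hz
    rw [← hGhom z ‖z‖⁻¹ (by positivity)]
    exact hmax (hunit z hz)
  have hEy := hE.pos hy0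
  have hθy : 0 < θ y := by
    have h1 : 0 < G v := by
      have := hE.pos hv0
      simp only [hG]; positivity
    have h2 := h1.trans_le (hle v hv0)
    by_contra hcon
    push Not at hcon
    have : G y ≤ 0 := by
      simp only [hG]
      exact div_nonpos_of_nonpos_of_nonneg
        (mul_nonpos_of_nonpos_of_nonneg hcon (abs_nonneg _)) hEy.le
    linarith
  -- The maximality of G with denominators cleared: the function vanishes at y and is nonnegative
  -- nearby.
  have hmin : IsLocalMin (fun z => θ y ^ 2 * E z - θ z ^ 2 * E y) y := by
    have e1 : ∀ᶠ z in 𝓝 y, 0 < θ z := θ.continuous.continuousAt.eventually (lt_mem_nhds hθy)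
    filter_upwards [e1, isOpen_ne.mem_nhds hy0] with z hz hz0
    have h1 := hle z hz0
    have hEz := hE.pos hz0
    simp only [hG, abs_of_pos hz, abs_of_pos hθy] at h1
    rw [div_le_div_iff₀ hEz hEy] at h1
    nlinarith
  have hdE := ((hE.smooth y hy0).differentiableAt (by simp)).hasFDerivAt
  have hd := ((hdE.const_mul (θ y ^ 2)).sub ((θ.hasFDerivAt.pow 2).mul_const (E y)))
  have hzero := hmin.hasFDerivAt_eq_zero hd
  have hkey : fderiv ℝ E y = (2 * E y / θ y) • θ := by
    ext w
    have := congrArg (fun T : V →L[ℝ] ℝ => T w) hzero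
    simp at this
    simp only [smul_apply, smul_eq_mul]
    field_simp
    have h3 : θ y * (θ y * fderiv ℝ E y w - 2 * E y * θ w) = 0 := by linarith
    rcases mul_eq_zero.1 h3 with h | h
    · exact absurd h hθy.ne'
    · linarith
  have hc : 0 < θ y / (2 * E y) := by positivity
  refine ⟨(θ y / (2 * E y)) • y, smul_ne_zero hc.ne' hy0, ?_⟩
  rw [hE.fderiv_smul y hc, hkey, smul_smul]
  have : θ y / (2 * E y) * (2 * E y / θ y) = 1 := by field_simp
  rw [this, one_smul]

/-- The inverse of the Legendre transform `y ↦ dE(y)`, with value `0` at `0`. -/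
noncomputable def legendreInv (hE : IsMinkowskiEnergy E) (θ : V →L[ℝ] ℝ) : V :=
  open Classical in
  if h : θ ≠ 0 then (hE.fderiv_surjective h).choose else 0

theorem legendreInv_ne_zero (hE : IsMinkowskiEnergy E) {θ : V →L[ℝ] ℝ} (hθ : θ ≠ 0) :
    hE.legendreInv θ ≠ 0 := by
  rw [legendreInv, dif_pos hθ]
  exact (hE.fderiv_surjective hθ).choose_spec.1

theorem fderiv_legendreInv (hE : IsMinkowskiEnergy E) {θ : V →L[ℝ] ℝ} (hθ : θ ≠ 0) :
    fderiv ℝ E (hE.legendreInv θ) = θ := by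
  rw [legendreInv, dif_pos hθ]
  exact (hE.fderiv_surjective hθ).choose_spec.2

theorem legendreInv_fderiv (hE : IsMinkowskiEnergy E) {y : V} (hy : y ≠ 0) :
    hE.legendreInv (fderiv ℝ E y) = y :=
  hE.fderiv_injective (hE.legendreInv_ne_zero (hE.fderiv_ne_zero hy)) hy
    (hE.fderiv_legendreInv (hE.fderiv_ne_zero hy))

/-- The Hessian of `E` as an isomorphism onto the dual space. -/
noncomputable def hessEquiv (hE : IsMinkowskiEnergy E) {y : V} (hy : y ≠ 0) :
    V ≃L[ℝ] (V →L[ℝ] ℝ) :=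
  (LinearEquiv.ofInjectiveOfFinrankEq
    (fderiv ℝ (fderiv ℝ E) y : V →ₗ[ℝ] (V →L[ℝ] ℝ))
    (by
      rw [← LinearMap.ker_eq_bot, LinearMap.ker_eq_bot']
      intro v hv
      by_contra hv0
      have := hE.hess_pos y hy v hv0
      have h2 : fderiv ℝ (fderiv ℝ E) y v = 0 := hv
      rw [h2] at this
      simp at this)
    (by
      rw [← (LinearMap.toContinuousLinearMap (𝕜 := ℝ) (E := V) (F' := ℝ)).finrank_eq]
      exact (Subspace.dual_finrank_eq).symm)).toContinuousLinearEquiv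

theorem coe_hessEquiv (hE : IsMinkowskiEnergy E) {y : V} (hy : y ≠ 0) :
    (hE.hessEquiv hy : V →L[ℝ] (V →L[ℝ] ℝ)) = fderiv ℝ (fderiv ℝ E) y := by
  ext v w
  rfl

/-- The inverse function theorem gives a smooth local inverse of dE. It agrees with `legendreInv`
near θ because dE is injective off the origin and the local inverse stays nonzero there. -/
theorem legendreInv_smooth (hE : IsMinkowskiEnergy E) {θ : V →L[ℝ] ℝ} (hθ : θ ≠ 0) :
    ContDiffAt ℝ ∞ hE.legendreInv θ := by
  have : CompleteSpace V := FiniteDimensional.complete ℝ V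
  set y := hE.legendreInv θ with hy
  have hy0 : y ≠ 0 := hE.legendreInv_ne_zero hθ
  have hf := hE.fderiv_smooth hy0
  have hf' : HasFDerivAt (fderiv ℝ E) (hE.hessEquiv hy0 : V →L[ℝ] (V →L[ℝ] ℝ)) y := by
    rw [coe_hessEquiv]
    exact (hf.differentiableAt (by simp)).hasFDerivAt
  have hn : (∞ : WithTop ℕ∞) ≠ 0 := by simp
  have hyθ : fderiv ℝ E y = θ := hE.fderiv_legendreInv hθ
  have h1 := hf.to_localInverse hf' hn
  have h2 := hf.localInverse_apply_image hf' hn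
  rw [hyθ] at h1 h2
  refine h1.congr_of_eventuallyEq ?_
  have h3 : ∀ᶠ η in 𝓝 θ, hf.localInverse hf' hn η ≠ 0 :=
    h1.continuousAt.eventually (by rw [h2]; exact isOpen_ne.mem_nhds hy0)
  have h4 : ∀ᶠ η in 𝓝 θ, fderiv ℝ E (hf.localInverse hf' hn η) = η := by
    have := (hf.hasStrictFDerivAt' hf' hn).eventually_right_inverse
    rw [hyθ] at this
    exact this
  filter_upwards [h3, h4, isOpen_ne.mem_nhds hθ] with η a1 a2 a3
  exact hE.fderiv_injective (hE.legendreInv_ne_zero a3) a1 ((hE.fderiv_legendreInv a3).trans a2.symm)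

end IsMinkowskiEnergy

/-! ### Positive semidefinite bilinear forms -/

section PosSemidef

variable {V : Type*} [NormedAddCommGroup V] [NormedSpace ℝ V] {B : V →L[ℝ] V →L[ℝ] ℝ}

theorem bilin_cauchySchwarz (hs : ∀ v w, B v w = B w v) (hB : ∀ v, 0 ≤ B v v) (v w : V) :
    B v w ^ 2 ≤ B v v * B w w := by
  have h : ∀ t : ℝ, 0 ≤ B w w * (t * t) + (2 * B v w) * t + B v v := by
    intro t
    have := hB (v + t • w)
    simp only [map_add, map_smul, add_apply, smul_apply, smul_eq_mul, hs w v] at this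
    linarith
  have := discrim_le_zero h
  rw [discrim] at this
  nlinarith

theorem bilin_eq_zero_of_self (hs : ∀ v w, B v w = B w v) (hB : ∀ v, 0 ≤ B v v) {v : V}
    (hv : B v v = 0) : B v = 0 := by
  ext w
  have := bilin_cauchySchwarz hs hB v w
  rw [hv, zero_mul] at this
  simpa using le_antisymm this (sq_nonneg _)

theorem bilin_eq_smul_of_cauchySchwarz_eq (hs : ∀ v w, B v w = B w v) (hB : ∀ v, 0 ≤ B v v)
    {v w : V} (hv : B v v ≠ 0) (h : B v w ^ 2 = B v v * B w w) :
    B w = (B v w / B v v) • B v := by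
  have h0 : B (w - (B v w / B v v) • v) = 0 := by
    apply bilin_eq_zero_of_self hs hB
    simp only [map_sub, map_smul, sub_apply, smul_apply, smul_eq_mul, hs w v]
    field_simp
    linarith
  rw [map_sub, map_smul, sub_eq_zero] at h0
  exact h0

end PosSemidef

/-- `E` is a Minkowski energy, and `2 E |grad α|²` is the quadratic form of `q`, where the gradient
of the linear form `α` is taken with respect to the Hessian of `E`. -/
structure HasQuadraticGradient {V : Type*} [NormedAddCommGroup V] [NormedSpace ℝ V] (E : V → ℝ)
    (α : V →L[ℝ] ℝ) (q : V →L[ℝ] V →L[ℝ] ℝ) : Prop where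
  energy : IsMinkowskiEnergy E
  ne_zero : α ≠ 0
  symm : ∀ v w, q v w = q w v
  grad : ∀ y, y ≠ 0 → ∀ X, fderiv ℝ (fderiv ℝ E) y X = α → 2 * E y * α X = q y y

/-! ### The semidefinite form q − α ⊗ α -/

namespace HasQuadraticGradient

variable {V : Type*} [NormedAddCommGroup V] [NormedSpace ℝ V]
  {E : V → ℝ} {α : V →L[ℝ] ℝ} {q : V →L[ℝ] V →L[ℝ] ℝ}

theorem neg (h : HasQuadraticGradient E α q) : HasQuadraticGradient E (-α) q where
  energy := h.energy
  ne_zero := neg_ne_zero.2 h.ne_zero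
  symm := h.symm
  grad y hy X hX := by
    have := h.grad y hy (-X) (by rw [map_neg, hX, neg_neg])
    simpa using this

/-- The bilinear form `q - α ⊗ α`. -/
noncomputable def defect (_ : HasQuadraticGradient E α q) : V →L[ℝ] V →L[ℝ] ℝ :=
  q - α.smulRight α

theorem defect_apply (h : HasQuadraticGradient E α q) (v w : V) :
    h.defect v w = q v w - α v * α w := by
  simp [defect]

theorem defect_symm (h : HasQuadraticGradient E α q) (v w : V) :
    h.defect v w = h.defect w v := by
  rw [defect_apply, defect_apply, h.symm, mul_comm]

variable [FiniteDimensional ℝ V]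

theorem pos (h : HasQuadraticGradient E α q) {y : V} (hy : y ≠ 0) : 0 < q y y := by
  set X := (h.energy.hessEquiv hy).symm α with hX
  have hX' : fderiv ℝ (fderiv ℝ E) y X = α := by
    rw [← h.energy.coe_hessEquiv hy]
    exact (h.energy.hessEquiv hy).apply_symm_apply α
  have hX0 : X ≠ 0 := by
    intro h0
    rw [h0, map_zero] at hX'
    exact h.ne_zero hX'.symm
  rw [← h.grad y hy X hX']
  have h1 := h.energy.hess_pos y hy X hX0
  rw [hX'] at h1
  have := h.energy.pos hy
  positivity

/-- This is α(y)² ≤ 2E |X|², the Cauchy-Schwarz inequality between y and the gradient X of α. -/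
theorem defect_nonneg (h : HasQuadraticGradient E α q) (y : V) : 0 ≤ h.defect y y := by
  rcases eq_or_ne y 0 with rfl | hy
  · simp
  set X := (h.energy.hessEquiv hy).symm α with hX
  have hX' : fderiv ℝ (fderiv ℝ E) y X = α := by
    rw [← h.energy.coe_hessEquiv hy]
    exact (h.energy.hessEquiv hy).apply_symm_apply α
  rw [defect_apply, ← h.grad y hy X hX']
  have := h.energy.sq_le_of_hess_eq hy hX'
  nlinarith

/-- Here the gradient of α is y/c, parallel to y, so that Cauchy-Schwarz is an equality; a null
vector of a semidefinite form lies in its radical. -/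
theorem defect_eq_zero_of_fderiv_eq (h : HasQuadraticGradient E α q) {y : V} (hy : y ≠ 0) {c : ℝ}
    (hc : c ≠ 0) (hyc : fderiv ℝ E y = c • α) : h.defect y = 0 := by
  apply bilin_eq_zero_of_self h.defect_symm h.defect_nonneg
  have h1 := h.grad y hy (c⁻¹ • y) (by
    rw [map_smul, h.energy.hess_self hy, hyc, smul_smul, inv_mul_cancel₀ hc, one_smul])
  have h2 := h.energy.fderiv_apply_self hy
  rw [hyc] at h2
  rw [defect_apply, ← h1, ← h2]
  simp only [smul_apply, map_smul, smul_eq_mul]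
  field_simp
  ring

/-- The positivity of the second momentum component off the axis. -/
theorem mul_apply_pos (h : HasQuadraticGradient E α q) {m y : V} (hm : m ≠ 0) (hαm : α m = 0)
    (hy : y ≠ 0) {c s : ℝ} (hs : s ≠ 0) (hyc : fderiv ℝ E y = c • α + s • q m) :
    0 < s * q m y := by
  -- If c = 0, the claim is dE(y)(y) = 2E > 0. Otherwise compare y with the vector y' where dE = c
  -- α: it lies in the radical of the defect, so q(m, y') = 0, and strict monotonicity of dE on y −
  -- y' leaves exactly s q(m, y) > 0.
  rcases eq_or_ne c 0 with rfl | hc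
  · have h1 := h.energy.fderiv_apply_self hy
    have h2 := h.energy.pos hy
    rw [hyc] at h1
    simp at h1
    linarith
  · have hcα : c • α ≠ 0 := smul_ne_zero hc h.ne_zero
    set y' := h.energy.legendreInv (c • α) with hy'
    have hy'0 : y' ≠ 0 := h.energy.legendreInv_ne_zero hcα
    have hy'c : fderiv ℝ E y' = c • α := h.energy.fderiv_legendreInv hcα
    have hz : q m y' = 0 := by
      have := congrArg (fun T : V →L[ℝ] ℝ => T m) (h.defect_eq_zero_of_fderiv_eq hy'0 hc hy'c)
      simp only [defect_apply, hαm, mul_zero, sub_zero] at this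
      rw [h.symm]
      simpa using this
    have hne : y' ≠ y := by
      rintro rfl
      rw [hy'c] at hyc
      have h3 : s • q m = 0 := by simpa using hyc
      have := congrArg (fun T : V →L[ℝ] ℝ => T m) h3
      simp [hs, (h.pos hm).ne'] at this
    have := h.energy.fderiv_strictMono hy'0 hy hne
    rw [hyc, hy'c, add_sub_cancel_left] at this
    simpa [hz] using this

end HasQuadraticGradient

/-! ### The curve over the ellipse spanned by two covectors -/

/-- The ellipse `cos φ · α + sin φ · ζ` in the dual space. -/
noncomputable def dualCircle {V : Type*} [NormedAddCommGroup V] [NormedSpace ℝ V]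
    (α ζ : V →L[ℝ] ℝ) (φ : ℝ) : V →L[ℝ] ℝ :=
  Real.cos φ • α + Real.sin φ • ζ

namespace HasQuadraticGradient

variable {V : Type*} [NormedAddCommGroup V] [NormedSpace ℝ V] [FiniteDimensional ℝ V]
  {E : V → ℝ} {α : V →L[ℝ] ℝ} {q : V →L[ℝ] V →L[ℝ] ℝ}

theorem dualCircle_ne_zero (h : HasQuadraticGradient E α q) {m : V} (hm : m ≠ 0) (hαm : α m = 0)
    (φ : ℝ) : dualCircle α (q m) φ ≠ 0 := by
  intro h0
  have h1 := congrArg (fun T : V →L[ℝ] ℝ => T m) h0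
  simp [dualCircle, hαm, (h.pos hm).ne'] at h1
  rw [dualCircle, h1, zero_smul, add_zero] at h0
  rcases smul_eq_zero.1 h0 with h2 | h2
  · have := Real.sin_sq_add_cos_sq φ
    rw [h1, h2] at this
    norm_num at this
  · exact h.ne_zero h2

/-- The curve whose Legendre transform is `dualCircle α (q m)`. -/
noncomputable def curve (h : HasQuadraticGradient E α q) (m : V) (φ : ℝ) : V :=
  h.energy.legendreInv (dualCircle α (q m) φ)

theorem curve_ne_zero (h : HasQuadraticGradient E α q) {m : V} (hm : m ≠ 0) (hαm : α m = 0)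
    (φ : ℝ) : h.curve m φ ≠ 0 :=
  h.energy.legendreInv_ne_zero (h.dualCircle_ne_zero hm hαm φ)

theorem fderiv_curve (h : HasQuadraticGradient E α q) {m : V} (hm : m ≠ 0) (hαm : α m = 0)
    (φ : ℝ) : fderiv ℝ E (h.curve m φ) = Real.cos φ • α + Real.sin φ • q m :=
  h.energy.fderiv_legendreInv (h.dualCircle_ne_zero hm hαm φ)

theorem curve_smooth (h : HasQuadraticGradient E α q) {m : V} (hm : m ≠ 0) (hαm : α m = 0) :
    ContDiff ℝ ∞ (h.curve m) := by
  rw [contDiff_iff_contDiffAt]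
  intro φ
  refine (h.energy.legendreInv_smooth (h.dualCircle_ne_zero hm hαm φ)).comp φ ?_
  unfold dualCircle
  exact ((Real.contDiff_cos.smul contDiff_const).add
    (Real.contDiff_sin.smul contDiff_const)).contDiffAt

theorem hasDerivAt_curve (h : HasQuadraticGradient E α q) {m : V} (hm : m ≠ 0) (hαm : α m = 0)
    (φ : ℝ) : HasDerivAt (h.curve m) (deriv (h.curve m) φ) φ :=
  ((h.curve_smooth hm hαm).differentiable (by simp) φ).hasDerivAt

theorem hess_deriv_curve (h : HasQuadraticGradient E α q) {m : V} (hm : m ≠ 0) (hαm : α m = 0)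
    (φ : ℝ) : fderiv ℝ (fderiv ℝ E) (h.curve m φ) (deriv (h.curve m) φ)
      = -Real.sin φ • α + Real.cos φ • q m := by
  have h1 := ((h.energy.fderiv_smooth (h.curve_ne_zero hm hαm φ)).differentiableAt
    (by simp)).hasFDerivAt.comp_hasDerivAt φ (h.hasDerivAt_curve hm hαm φ)
  have h2 : HasDerivAt (fun φ => Real.cos φ • α + Real.sin φ • q m)
      (-Real.sin φ • α + Real.cos φ • q m) φ :=
    ((Real.hasDerivAt_cos φ).smul_const α).add ((Real.hasDerivAt_sin φ).smul_const (q m))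
  refine h1.unique (h2.congr_of_eventuallyEq (Eventually.of_forall fun ψ => ?_))
  exact h.fderiv_curve hm hαm ψ

theorem hasDerivAt_apply_curve (h : HasQuadraticGradient E α q) {m : V} (hm : m ≠ 0)
    (hαm : α m = 0) (η : V →L[ℝ] ℝ) (φ : ℝ) :
    HasDerivAt (fun φ => η (h.curve m φ)) (η (deriv (h.curve m) φ)) φ :=
  η.hasFDerivAt.comp_hasDerivAt φ (h.hasDerivAt_curve hm hαm φ)

theorem two_mul_energy_curve (h : HasQuadraticGradient E α q) {m : V} (hm : m ≠ 0)
    (hαm : α m = 0) (φ : ℝ) : 2 * E (h.curve m φ)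
      = Real.cos φ * α (h.curve m φ) + Real.sin φ * q m (h.curve m φ) := by
  rw [← h.energy.fderiv_apply_self (h.curve_ne_zero hm hαm φ), h.fderiv_curve hm hαm]
  simp

theorem deriv_curve_relation (h : HasQuadraticGradient E α q) {m : V} (hm : m ≠ 0)
    (hαm : α m = 0) (φ : ℝ) :
    Real.cos φ * α (deriv (h.curve m) φ) + Real.sin φ * q m (deriv (h.curve m) φ)
      = -Real.sin φ * α (h.curve m φ) + Real.cos φ * q m (h.curve m φ) := by
  have h1 := h.energy.hess_apply_self (h.curve_ne_zero hm hαm φ) (deriv (h.curve m) φ)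
  rw [h.hess_deriv_curve hm hαm, h.fderiv_curve hm hαm] at h1
  simp at h1
  linarith

/-- Rotating the frame (dE(y), its φ-derivative) back by φ shows that cos φ · y − sin φ · y' is the
gradient of α at y. Inserting it into the hypothesis on q expresses the defect through the Wronskian
of α(y) and q(m, y). -/
theorem defect_curve (h : HasQuadraticGradient E α q) {m : V} (hm : m ≠ 0) (hαm : α m = 0)
    (φ : ℝ) : h.defect (h.curve m φ) (h.curve m φ) = Real.sin φ ^ 2 *
      (α (h.curve m φ) * q m (deriv (h.curve m) φ)
        - α (deriv (h.curve m) φ) * q m (h.curve m φ)) := by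
  have h0 := h.curve_ne_zero hm hαm φ
  have hcs := Real.sin_sq_add_cos_sq φ
  have h1 := h.grad _ h0 (Real.cos φ • h.curve m φ - Real.sin φ • deriv (h.curve m) φ) (by
    rw [map_sub, map_smul, map_smul, h.energy.hess_self h0, h.fderiv_curve hm hαm,
      h.hess_deriv_curve hm hαm]
    have : α = (Real.sin φ ^ 2 + Real.cos φ ^ 2) • α := by rw [hcs, one_smul]
    conv_rhs => rw [this]
    module)
  rw [defect_apply, ← h1, h.two_mul_energy_curve hm hαm]
  have h2 := h.deriv_curve_relation hm hαm φ
  simp only [map_sub, map_smul, smul_eq_mul]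
  set u := α (h.curve m φ)
  set k := q m (h.curve m φ)
  set u' := α (deriv (h.curve m) φ)
  set k' := q m (deriv (h.curve m) φ)
  set c := Real.cos φ
  set s := Real.sin φ
  linear_combination (-s * u) * h2 + u ^ 2 * hcs

/-- The function `-cot φ + q(m, m) α(y) / q(m, y)` along the curve. -/
noncomputable def slopeFn (h : HasQuadraticGradient E α q) (m : V) (φ : ℝ) : ℝ :=
  -(Real.cos φ / Real.sin φ) + q m m * (α (h.curve m φ) / q m (h.curve m φ))

theorem sin_mul_curve_pos (h : HasQuadraticGradient E α q) {m : V} (hm : m ≠ 0) (hαm : α m = 0)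
    {φ : ℝ} (hφ : Real.sin φ ≠ 0) : 0 < Real.sin φ * q m (h.curve m φ) :=
  h.mul_apply_pos hm hαm (h.curve_ne_zero hm hαm φ) hφ (h.fderiv_curve hm hαm φ)

/-- The quotient α(y)/q(m, y) differentiates to minus the Wronskian over q(m, y)², and
`defect_curve` turns this into the defect; −cot contributes 1/sin². -/
theorem hasDerivAt_slopeFn (h : HasQuadraticGradient E α q) {m : V} (hm : m ≠ 0) (hαm : α m = 0)
    {φ : ℝ} (hφ : Real.sin φ ≠ 0) : HasDerivAt (h.slopeFn m)
      ((q m (h.curve m φ) ^ 2 - q m m * h.defect (h.curve m φ) (h.curve m φ))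
        / (Real.sin φ ^ 2 * q m (h.curve m φ) ^ 2)) φ := by
  have hk : q m (h.curve m φ) ≠ 0 := (mul_ne_zero_iff.1 (h.sin_mul_curve_pos hm hαm hφ).ne').2
  have h1 := ((Real.hasDerivAt_cos φ).div (Real.hasDerivAt_sin φ) hφ).neg
  have h2 := ((h.hasDerivAt_apply_curve hm hαm α φ).div
    (h.hasDerivAt_apply_curve hm hαm (q m) φ) hk).const_mul (q m m)
  refine (h1.add h2).congr_deriv ?_
  rw [h.defect_curve hm hαm]
  have hcs := Real.sin_sq_add_cos_sq φ
  set u := α (h.curve m φ)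
  set k := q m (h.curve m φ)
  set u' := α (deriv (h.curve m) φ)
  set k' := q m (deriv (h.curve m) φ)
  field_simp
  linear_combination (k ^ 2) * hcs

/-- Because α(m) = 0, pairing with m gives the same result for the defect and for q. -/
theorem defect_cauchySchwarz_curve (h : HasQuadraticGradient E α q) {m : V} (hαm : α m = 0)
    (y : V) : q m y ^ 2 ≤ q m m * h.defect y y := by
  have := bilin_cauchySchwarz h.defect_symm h.defect_nonneg m y
  simpa [h.defect_apply m, hαm] using this

theorem antitoneOn_slopeFn (h : HasQuadraticGradient E α q) {m : V} (hm : m ≠ 0)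
    (hαm : α m = 0) : AntitoneOn (h.slopeFn m) (Ioo 0 Real.pi) := by
  have hs : ∀ φ ∈ Ioo 0 Real.pi, Real.sin φ ≠ 0 := fun φ hφ => (Real.sin_pos_of_mem_Ioo hφ).ne'
  apply antitoneOn_of_deriv_nonpos (convex_Ioo _ _)
  · exact fun φ hφ => (h.hasDerivAt_slopeFn hm hαm (hs φ hφ)).continuousAt.continuousWithinAt
  · exact fun φ hφ => (h.hasDerivAt_slopeFn hm hαm
      (hs φ (interior_subset hφ))).differentiableAt.differentiableWithinAt
  · intro φ hφ
    rw [(h.hasDerivAt_slopeFn hm hαm (hs φ (interior_subset hφ))).deriv]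
    apply div_nonpos_of_nonpos_of_nonneg
    · have := h.defect_cauchySchwarz_curve hαm (h.curve m φ)
      linarith
    · positivity

/-- Changing the sign of both α and m is a half-turn of the ellipse of covectors. Results at the
pole φ = 0 thus carry over to the pole φ = π. -/
theorem slopeFn_neg (h : HasQuadraticGradient E α q) (m : V) (φ : ℝ) :
    h.neg.slopeFn (-m) φ = h.slopeFn m (φ + Real.pi) := by
  have h1 : dualCircle (-α) (q (-m)) φ = dualCircle α (q m) (φ + Real.pi) := by
    rw [dualCircle, dualCircle, Real.cos_add_pi, Real.sin_add_pi, map_neg]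
    module
  have h2 : h.neg.curve (-m) φ = h.curve m (φ + Real.pi) := by
    rw [curve, curve, h1]
  simp [slopeFn, h2, Real.cos_add_pi, Real.sin_add_pi, neg_div_neg_eq]

end HasQuadraticGradient

/-- A double zero divided by t² has a removable singularity; L'Hôpital gives the value ν''(0)/2. -/
theorem exists_tendsto_div_sq {ν : ℝ → ℝ} (hν : ContDiff ℝ ∞ ν) (h0 : ν 0 = 0)
    (h1 : deriv ν 0 = 0) : ∃ b, Tendsto (fun t => ν t / t ^ 2) (𝓝[≠] 0) (𝓝 b) := by
  have hd : Differentiable ℝ ν := hν.differentiable (by simp)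
  have hdd : ContDiff ℝ ∞ (deriv ν) := (contDiff_infty_iff_deriv.1 hν).2
  refine ⟨deriv (deriv ν) 0 / 2, deriv.lhopital_zero_nhdsNE (Eventually.of_forall hd) ?_ ?_ ?_ ?_⟩
  · filter_upwards [self_mem_nhdsWithin] with t ht
    simpa using ht
  · have := hd.continuous.tendsto 0
    rw [h0] at this
    exact this.mono_left nhdsWithin_le_nhds
  · have : Continuous fun t : ℝ => t ^ 2 := by fun_prop
    have := this.tendsto 0
    simp only [ne_eq, OfNat.ofNat_ne_zero, not_false_eq_true, zero_pow] at this
    exact this.mono_left nhdsWithin_le_nhds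
  · have h2 := (hdd.differentiable (by simp) 0).hasDerivAt.tendsto_slope_zero
    have h3 := h2.div_const 2
    refine h3.congr fun t => ?_
    simp [h1]
    ring

/-! ### Behaviour at the poles and rigidity -/

namespace HasQuadraticGradient

variable {V : Type*} [NormedAddCommGroup V] [NormedSpace ℝ V] [FiniteDimensional ℝ V]
  {E : V → ℝ} {α : V →L[ℝ] ℝ} {q : V →L[ℝ] V →L[ℝ] ℝ}

/-- The vector whose Legendre transform is `α`. -/
noncomputable def pole (h : HasQuadraticGradient E α q) : V := h.energy.legendreInv α

theorem pole_ne_zero (h : HasQuadraticGradient E α q) : h.pole ≠ 0 :=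
  h.energy.legendreInv_ne_zero h.ne_zero

theorem fderiv_pole (h : HasQuadraticGradient E α q) : fderiv ℝ E h.pole = α :=
  h.energy.fderiv_legendreInv h.ne_zero

theorem apply_pole_pos (h : HasQuadraticGradient E α q) : 0 < α h.pole := by
  have h1 := h.energy.fderiv_apply_self h.pole_ne_zero
  have h2 := h.energy.pos h.pole_ne_zero
  rw [h.fderiv_pole] at h1
  linarith

theorem defect_pole (h : HasQuadraticGradient E α q) : h.defect h.pole = 0 :=
  h.defect_eq_zero_of_fderiv_eq h.pole_ne_zero one_ne_zero (by rw [h.fderiv_pole, one_smul])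

theorem apply_pole (h : HasQuadraticGradient E α q) (v : V) : q h.pole v = α h.pole * α v := by
  have := congrArg (fun T : V →L[ℝ] ℝ => T v) h.defect_pole
  simp only [defect_apply, zero_apply] at this
  linarith

theorem curve_zero (h : HasQuadraticGradient E α q) (m : V) : h.curve m 0 = h.pole := by
  simp [curve, pole, dualCircle]

theorem apply_curve_zero (h : HasQuadraticGradient E α q) {m : V} (hαm : α m = 0) :
    q m (h.curve m 0) = 0 := by
  rw [h.curve_zero, h.symm, h.apply_pole, hαm, mul_zero]

theorem hess_deriv_curve_zero (h : HasQuadraticGradient E α q) {m : V} (hm : m ≠ 0)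
    (hαm : α m = 0) : fderiv ℝ (fderiv ℝ E) h.pole (deriv (h.curve m) 0) = q m := by
  have := h.hess_deriv_curve hm hαm 0
  simpa [h.curve_zero] using this

/-- The form q is positive on nonzero vectors, hence nondegenerate. -/
theorem exists_dual (h : HasQuadraticGradient E α q) (η : V →L[ℝ] ℝ) : ∃ m, q m = η := by
  have hinj : Function.Injective (q : V →ₗ[ℝ] (V →L[ℝ] ℝ)) := by
    rw [← LinearMap.ker_eq_bot, LinearMap.ker_eq_bot']
    intro v hv
    by_contra hv0
    have := h.pos hv0
    have h2 : q v = 0 := hv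
    rw [h2] at this
    simp at this
  have hfin : Module.finrank ℝ V = Module.finrank ℝ (V →L[ℝ] ℝ) := by
    rw [← (LinearMap.toContinuousLinearMap (𝕜 := ℝ) (E := V) (F' := ℝ)).finrank_eq]
    exact (Subspace.dual_finrank_eq).symm
  obtain ⟨m, hm⟩ := (LinearEquiv.ofInjectiveOfFinrankEq _ hinj hfin).surjective η
  exact ⟨m, hm⟩

/-- Divide `defect_curve` by t² and let t → 0. The pole is in the radical of the defect, so the left
side depends only on the difference quotient of the curve. -/
theorem self_deriv_curve_zero (h : HasQuadraticGradient E α q) {m : V} (hm : m ≠ 0)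
    (hαm : α m = 0) : h.defect (deriv (h.curve m) 0) (deriv (h.curve m) 0)
      = α h.pole * q m (deriv (h.curve m) 0) := by
  set y := h.curve m with hy
  have hslope := (h.hasDerivAt_curve hm hαm 0).tendsto_slope_zero
  simp only [zero_add, h.curve_zero] at hslope
  have hL : Tendsto (fun t : ℝ => h.defect (t⁻¹ • (y t - h.pole)) (t⁻¹ • (y t - h.pole)))
      (𝓝[≠] 0) (𝓝 (h.defect (deriv y 0) (deriv y 0))) := by
    have hc : Continuous fun v => h.defect v v := by fun_prop
    exact (hc.tendsto _).comp hslope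
  have hsin : Tendsto (fun t : ℝ => t⁻¹ * Real.sin t) (𝓝[≠] 0) (𝓝 1) := by
    simpa using (Real.hasDerivAt_sin 0).tendsto_slope_zero
  have hdc : Continuous (deriv y) :=
    (contDiff_infty_iff_deriv.1 (h.curve_smooth hm hαm)).2.continuous
  have hyc : Continuous y := (h.curve_smooth hm hαm).continuous
  have hR : Tendsto (fun t : ℝ => (t⁻¹ * Real.sin t) ^ 2 *
      (α (y t) * q m (deriv y t) - α (deriv y t) * q m (y t))) (𝓝[≠] 0)
      (𝓝 (1 ^ 2 * (α (y 0) * q m (deriv y 0) - α (deriv y 0) * q m (y 0)))) := by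
    refine (hsin.pow 2).mul ?_
    have : Continuous fun t => α (y t) * q m (deriv y t) - α (deriv y t) * q m (y t) := by fun_prop
    exact (this.tendsto 0).mono_left nhdsWithin_le_nhds
  have hEq : ∀ t : ℝ, h.defect (t⁻¹ • (y t - h.pole)) (t⁻¹ • (y t - h.pole))
      = (t⁻¹ * Real.sin t) ^ 2 * (α (y t) * q m (deriv y t) - α (deriv y t) * q m (y t)) := by
    intro t
    have h1 := h.defect_curve hm hαm t
    have h2 : h.defect (y t) h.pole = 0 := by
      rw [h.defect_symm, h.defect_pole]; simp
    simp only [map_smul, map_sub, smul_apply, sub_apply, smul_eq_mul, h.defect_pole, h2,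
      zero_apply]
    rw [h1]
    ring
  have := tendsto_nhds_unique (hL.congr hEq) hR
  rw [this, h.apply_curve_zero hαm, show y 0 = h.pole from h.curve_zero m]
  ring

/-- On the kernel of `α`, the form `q` is a multiple of the Hessian of `E` at the pole. -/
theorem self_eq_hess_pole (h : HasQuadraticGradient E α q) {v : V} (hv : α v = 0) :
    q v v = α h.pole * fderiv ℝ (fderiv ℝ E) h.pole v v := by
  rcases eq_or_ne v 0 with rfl | hv0
  · simp
  -- With this m the curve leaves the pole with velocity v, so `self_deriv_curve_zero` applies to v
  -- itself.
  obtain ⟨m, hm⟩ := h.exists_dual (fderiv ℝ (fderiv ℝ E) h.pole v)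
  have hαm : α m = 0 := by
    have h1 := h.apply_pole m
    rw [h.symm, hm, h.energy.hess_apply_self h.pole_ne_zero, h.fderiv_pole, hv] at h1
    exact (mul_eq_zero.1 h1.symm).resolve_left h.apply_pole_pos.ne'
  have hm0 : m ≠ 0 := by
    rintro rfl
    have := h.energy.hess_pos _ h.pole_ne_zero v hv0
    rw [← hm] at this
    simp at this
  have hd : deriv (h.curve m) 0 = v := by
    apply (h.energy.hessEquiv h.pole_ne_zero).injective
    have h1 := (h.hess_deriv_curve_zero hm0 hαm).trans hm
    rw [← h.energy.coe_hessEquiv h.pole_ne_zero] at h1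
    exact h1
  have := h.self_deriv_curve_zero hm0 hαm
  rw [hd, defect_apply, hv, hm] at this
  simpa using this

theorem eq_hess_pole (h : HasQuadraticGradient E α q) {v w : V} (hv : α v = 0) (hw : α w = 0) :
    q v w = α h.pole * fderiv ℝ (fderiv ℝ E) h.pole v w := by
  have h1 := h.self_eq_hess_pole hv
  have h2 := h.self_eq_hess_pole hw
  have h3 := h.self_eq_hess_pole (v := v + w) (by rw [map_add, hv, hw, add_zero])
  simp only [map_add, add_apply] at h3
  rw [h.symm w v, h.energy.hess_symm h.pole_ne_zero w v] at h3
  linarith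

/-- The initial velocity is α(pole) m: both q and the Hessian at the pole are known on ker α, and
their proportionality makes the difference of the two vectors null for q. This is the first-order
matching that makes `slopeFn` extend over the pole. -/
theorem apply_deriv_curve_zero (h : HasQuadraticGradient E α q) {m : V} (hm : m ≠ 0)
    (hαm : α m = 0) : q m (deriv (h.curve m) 0) = α h.pole * q m m := by
  set v := deriv (h.curve m) 0 with hvdef
  have hg := h.hess_deriv_curve_zero hm hαm
  have hv : α v = 0 := by
    rw [← h.fderiv_pole, ← h.energy.hess_apply_self h.pole_ne_zero, hg, ← h.curve_zero m,
      h.apply_curve_zero hαm]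
  have hw : α (v - α h.pole • m) = 0 := by simp [hv, hαm]
  have h2 : q (v - α h.pole • m) (v - α h.pole • m) = 0 := by
    have h3 := h.eq_hess_pole hv hw
    rw [← hvdef] at hg
    rw [hg] at h3
    rw [map_sub q, map_smul q, sub_apply, smul_apply, h3, smul_eq_mul, sub_self]
  have h4 : v - α h.pole • m = 0 := by
    by_contra h0
    exact (h.pos h0).ne' h2
  rw [sub_eq_zero.1 h4]
  simp

/-- Over the common denominator sin t · q(m, y), which has a zero of exact order two at t = 0, the
numerator ν vanishes to second order. The limit is two-sided, which lets both half-turns share it.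
-/
theorem exists_tendsto_slopeFn (h : HasQuadraticGradient E α q) {m : V} (hm : m ≠ 0)
    (hαm : α m = 0) : ∃ b, Tendsto (h.slopeFn m) (𝓝[≠] 0) (𝓝 b) := by
  set y := h.curve m with hy
  have hys := h.curve_smooth hm hαm
  have hu : ContDiff ℝ ∞ fun t => α (y t) := α.contDiff.comp hys
  have hk : ContDiff ℝ ∞ fun t => q m (y t) := (q m).contDiff.comp hys
  set ν : ℝ → ℝ := fun t => q m m * (α (y t) * Real.sin t) - Real.cos t * q m (y t) with hν
  have hνs : ContDiff ℝ ∞ ν :=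
    (contDiff_const.mul (hu.mul Real.contDiff_sin)).sub (Real.contDiff_cos.mul hk)
  have hν0 : ν 0 = 0 := by
    simp [hν, hy, h.apply_curve_zero hαm]
  have hν1 : deriv ν 0 = 0 := by
    have h1 := (((h.hasDerivAt_apply_curve hm hαm α 0).mul (Real.hasDerivAt_sin 0)).const_mul
      (q m m)).sub ((Real.hasDerivAt_cos 0).mul (h.hasDerivAt_apply_curve hm hαm (q m) 0))
    have h2 := h1.deriv
    refine Eq.trans ?_ (h2.trans ?_)
    · rfl
    · rw [h.apply_deriv_curve_zero hm hαm, h.apply_curve_zero hαm, h.curve_zero]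
      simp
      ring
  obtain ⟨b, hb⟩ := exists_tendsto_div_sq hνs hν0 hν1
  have hsin : Tendsto (fun t : ℝ => t⁻¹ * Real.sin t) (𝓝[≠] 0) (𝓝 1) := by
    simpa using (Real.hasDerivAt_sin 0).tendsto_slope_zero
  have hk' : Tendsto (fun t : ℝ => t⁻¹ * q m (y t)) (𝓝[≠] 0) (𝓝 (α h.pole * q m m)) := by
    have := (h.hasDerivAt_apply_curve hm hαm (q m) 0).tendsto_slope_zero
    rw [h.apply_deriv_curve_zero hm hαm] at this
    simpa [h.apply_curve_zero hαm] using this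
  have hne : α h.pole * q m m ≠ 0 := (mul_pos h.apply_pole_pos (h.pos hm)).ne'
  have hlim := hb.div (hsin.mul hk') (by simpa using hne)
  refine ⟨_, hlim.congr' ?_⟩
  have hnear : ∀ᶠ t : ℝ in 𝓝[≠] 0, Real.sin t ≠ 0 := by
    have := hsin.eventually (isOpen_ne.mem_nhds (one_ne_zero : (1 : ℝ) ≠ 0))
    filter_upwards [this] with t ht h0
    simp [h0] at ht
  filter_upwards [hnear, self_mem_nhdsWithin] with t ht ht0
  have ht0' : t ≠ 0 := ht0
  have hkt : q m (h.curve m t) ≠ 0 := (mul_ne_zero_iff.1 (h.sin_mul_curve_pos hm hαm ht).ne').2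
  simp only [Pi.div_apply, hν, slopeFn, hy]
  field_simp
  ring

/-- `slopeFn` is squeezed between its limits at the two poles. -/
theorem slopeFn_mem_Icc (h : HasQuadraticGradient E α q) {m : V} (hm : m ≠ 0) (hαm : α m = 0)
    {b b' : ℝ} (hb : Tendsto (h.slopeFn m) (𝓝[≠] 0) (𝓝 b))
    (hb' : Tendsto (h.neg.slopeFn (-m)) (𝓝[≠] 0) (𝓝 b')) {φ : ℝ} (hφ : φ ∈ Ioo 0 Real.pi) :
    h.slopeFn m φ ∈ Icc b' b := by
  have hanti := h.antitoneOn_slopeFn hm hαm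
  have l0 : Tendsto (h.slopeFn m) (𝓝[>] 0) (𝓝 b) :=
    hb.mono_left (nhdsWithin_mono _ fun x hx => ne_of_gt hx)
  have l1 : Tendsto (h.slopeFn m) (𝓝[<] Real.pi) (𝓝 b') := by
    have hshift : Tendsto (fun t : ℝ => t - Real.pi) (𝓝[<] Real.pi) (𝓝[≠] 0) := by
      apply tendsto_nhdsWithin_of_tendsto_nhds_of_eventually_within
      · have : Continuous fun t : ℝ => t - Real.pi := by fun_prop
        have := this.tendsto Real.pi
        rw [sub_self] at this
        exact this.mono_left nhdsWithin_le_nhds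
      · filter_upwards [self_mem_nhdsWithin] with t ht
        exact (sub_neg.2 ht).ne
    refine (hb'.comp hshift).congr fun t => ?_
    simp [h.slopeFn_neg]
  constructor
  · refine le_of_tendsto l1 ?_
    filter_upwards [Ioo_mem_nhdsLT hφ.2] with t ht
    exact hanti hφ ⟨hφ.1.trans ht.1, ht.2⟩ ht.1.le
  · refine ge_of_tendsto l0 ?_
    filter_upwards [Ioo_mem_nhdsGT hφ.1] with t ht
    exact hanti ⟨ht.1, ht.2.trans hφ.2⟩ hφ ht.2.le

/-- On one half-turn `slopeFn` decreases from b to b', on the other from b' to b. So it is constant,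
and its zero derivative is the equality. -/
theorem cauchySchwarz_eq_curve (h : HasQuadraticGradient E α q) {m : V} (hm : m ≠ 0)
    (hαm : α m = 0) {φ : ℝ} (hφ : φ ∈ Ioo 0 Real.pi) :
    q m (h.curve m φ) ^ 2 = q m m * h.defect (h.curve m φ) (h.curve m φ) := by
  have hm' : -m ≠ 0 := neg_ne_zero.2 hm
  have hαm' : (-α) (-m) = 0 := by simp [hαm]
  obtain ⟨b, hb⟩ := h.exists_tendsto_slopeFn hm hαm
  obtain ⟨b', hb'⟩ := h.neg.exists_tendsto_slopeFn hm' hαm'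
  -- Two sign changes amount to a full turn, so the limit at the end of the second half-turn is
  -- again b.
  have hnn : Tendsto (h.neg.neg.slopeFn (- -m)) (𝓝[≠] 0) (𝓝 b) := by
    refine hb.congr fun t => ?_
    rw [h.neg.slopeFn_neg, h.slopeFn_neg]
    have h1 : dualCircle α (q m) (t + Real.pi + Real.pi) = dualCircle α (q m) t := by
      simp [dualCircle, Real.cos_add_pi, Real.sin_add_pi]
    simp [slopeFn, curve, h1, Real.cos_add_pi, Real.sin_add_pi]
  have hle : b ≤ b' := by
    have := h.neg.slopeFn_mem_Icc hm' hαm' hb' hnn hφ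
    exact this.1.trans this.2
  have hconst : ∀ t ∈ Ioo 0 Real.pi, h.slopeFn m t = b := by
    intro t ht
    have := h.slopeFn_mem_Icc hm hαm hb hb' ht
    exact le_antisymm this.2 (hle.trans this.1)
  have hs := (Real.sin_pos_of_mem_Ioo hφ).ne'
  have hk : q m (h.curve m φ) ≠ 0 := (mul_ne_zero_iff.1 (h.sin_mul_curve_pos hm hαm hs).ne').2
  have hd := h.hasDerivAt_slopeFn hm hαm hs
  have hd0 : HasDerivAt (h.slopeFn m) 0 φ := by
    refine (hasDerivAt_const φ b).congr_of_eventuallyEq ?_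
    filter_upwards [isOpen_Ioo.mem_nhds hφ] with t ht using hconst t ht
  have h0 := hd.unique hd0
  rw [div_eq_zero_iff] at h0
  rcases h0 with h0 | h0
  · linarith
  · exact absurd h0 (by positivity)

/-- The differential of the quadratic form `2 E |grad α|²` lies in the span of `α` and `dE`. -/
theorem exists_eq_combination (h : HasQuadraticGradient E α q) {y : V} (hy : y ≠ 0) :
    ∃ a b : ℝ, q y = a • α + b • fderiv ℝ E y := by
  set θ := fderiv ℝ E y with hθ
  -- This c makes θ − c α vanish on the pole; since q(pole, ·) is a positive multiple of α, the
  -- vector m dual to θ − c α then satisfies α(m) = 0.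
  set c := θ h.pole / α h.pole with hc
  have hp := h.apply_pole_pos
  obtain ⟨m, hm⟩ := h.exists_dual (θ - c • α)
  have hθm : θ = c • α + q m := by rw [hm]; abel
  have hαm : α m = 0 := by
    have h1 := h.apply_pole m
    rw [h.symm, hm] at h1
    simp only [sub_apply, smul_apply, smul_eq_mul, hc] at h1
    rw [div_mul_cancel₀ _ hp.ne', sub_self] at h1
    exact (mul_eq_zero.1 h1.symm).resolve_left hp.ne'
  rcases eq_or_ne m 0 with rfl | hm0
  · rw [map_zero, add_zero] at hθm
    have hc0 : c ≠ 0 := by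
      intro h0
      rw [h0, zero_smul] at hθm
      exact h.energy.fderiv_ne_zero hy hθm
    refine ⟨α y, 0, ?_⟩
    ext v
    have := congrArg (fun T : V →L[ℝ] ℝ => T v) (h.defect_eq_zero_of_fderiv_eq hy hc0 hθm)
    simp only [defect_apply, zero_apply] at this
    simp
    linarith
  -- Scaling (c, 1) to the unit circle places y/r on the curve; the positive second coordinate puts
  -- the angle in (0, π).
  · set r := Real.sqrt (1 + c ^ 2) with hr
    have hr0 : 0 < r := Real.sqrt_pos.2 (by positivity)
    have hr2 : r ^ 2 = 1 + c ^ 2 := Real.sq_sqrt (by positivity)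
    obtain ⟨φ, hφ, hcos, hsin⟩ : ∃ φ ∈ Ioo 0 Real.pi, Real.cos φ = r⁻¹ * c ∧ Real.sin φ = r⁻¹ := by
      have habs : |r⁻¹ * c| < 1 := by
        rw [← sq_lt_one_iff_abs_lt_one, mul_pow, inv_pow, hr2, inv_mul_lt_one₀ (by positivity)]
        linarith
      rw [abs_lt] at habs
      refine ⟨Real.arccos (r⁻¹ * c), ⟨Real.arccos_pos.2 habs.2, ?_⟩,
        Real.cos_arccos habs.1.le habs.2.le, ?_⟩
      · refine lt_of_le_of_ne (Real.arccos_le_pi _) fun h0 => ?_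
        rw [Real.arccos_eq_pi] at h0
        linarith
      · rw [Real.sin_arccos, Real.sqrt_eq_iff_mul_self_eq_of_pos (by positivity)]
        field_simp
        linarith
    have hcurve : h.curve m φ = r⁻¹ • y := by
      have h1 : dualCircle α (q m) φ = fderiv ℝ E (r⁻¹ • y) := by
        rw [h.energy.fderiv_smul y (by positivity), ← hθ, hθm, dualCircle, hcos, hsin]
        module
      rw [curve, h1, h.energy.legendreInv_fderiv (smul_ne_zero (by positivity) hy)]
    have h1 := h.cauchySchwarz_eq_curve hm0 hαm hφ
    rw [hcurve] at h1
    have hdm : ∀ v, h.defect m v = q m v := fun v => by simp [defect_apply, hαm]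
    have h2 := bilin_eq_smul_of_cauchySchwarz_eq h.defect_symm h.defect_nonneg
      (v := m) (w := r⁻¹ • y) (by rw [hdm]; exact (h.pos hm0).ne') (by rw [hdm, hdm, h1])
    obtain ⟨d, hd⟩ : ∃ d : ℝ, h.defect y = d • q m := by
      set d₀ := h.defect m (r⁻¹ • y) / h.defect m m
      refine ⟨r * d₀, ?_⟩
      ext v
      have h3 := congrArg (fun T : V →L[ℝ] ℝ => T v) h2
      simp only [map_smul, smul_apply, smul_eq_mul, hdm] at h3 ⊢
      rw [mul_assoc, ← h3, mul_inv_cancel_left₀ hr0.ne']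
    refine ⟨α y - d * c, d, ?_⟩
    ext v
    have h4 := congrArg (fun T : V →L[ℝ] ℝ => T v) hd
    have h5 := congrArg (fun T : V →L[ℝ] ℝ => T v) hθm
    simp only [defect_apply, add_apply, smul_apply, smul_eq_mul] at h4 h5 ⊢
    rw [h5]
    linarith

end HasQuadraticGradient

/-! ### Smoothness of determinants and inverse matrices -/

section Matrix

variable {W : Type*} [NormedAddCommGroup W] [NormedSpace ℝ W] {n : ℕ}

theorem contDiffAt_det {A : W → Matrix (Fin n) (Fin n) ℝ} {y : W}
    (hA : ∀ i j, ContDiffAt ℝ ∞ (fun z => A z i j) y) : ContDiffAt ℝ ∞ (fun z => (A z).det) y := by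
  simp only [Matrix.det_apply]
  refine ContDiffAt.sum fun σ _ => ?_
  exact (contDiffAt_prod fun i _ => hA _ _).const_smul _

theorem contDiffAt_inv_entry {A : W → Matrix (Fin n) (Fin n) ℝ} {y : W}
    (hA : ∀ i j, ContDiffAt ℝ ∞ (fun z => A z i j) y) (hdet : (A y).det ≠ 0) (i j : Fin n) :
    ContDiffAt ℝ ∞ (fun z => (A z)⁻¹ i j) y := by
  have h1 : (fun z => (A z)⁻¹ i j) = fun z => (A z).det⁻¹ * (A z).adjugate i j := by
    funext z
    rw [Matrix.inv_def, Ring.inverse_eq_inv', Matrix.smul_apply, smul_eq_mul]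
  rw [h1]
  refine ((contDiffAt_det hA).inv hdet).mul ?_
  simp only [Matrix.adjugate_apply]
  refine contDiffAt_det fun k l => ?_
  by_cases hk : k = j
  · subst hk
    simp only [Matrix.updateRow_self]
    exact contDiffAt_const
  · simp only [Matrix.updateRow_ne hk]
    exact hA k l

end Matrix

/-! ### Partial derivatives of functions that are smooth away from the origin -/

section PartialDerivatives

variable {n : ℕ}

/-- `h` is smooth away from the origin. -/
def SmoothOff (h : EuclideanSpace ℝ (Fin n) → ℝ) : Prop := ∀ y, y ≠ 0 → ContDiffAt ℝ ∞ h y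

theorem SmoothOff.differentiableAt {h : EuclideanSpace ℝ (Fin n) → ℝ} (hh : SmoothOff h)
    {y : EuclideanSpace ℝ (Fin n)} (hy : y ≠ 0) : DifferentiableAt ℝ h y :=
  (hh y hy).differentiableAt (by simp)

theorem SmoothOff.pd {h : EuclideanSpace ℝ (Fin n) → ℝ} (hh : SmoothOff h) (i : Fin n) :
    SmoothOff (pd i h) := fun y hy =>
  ((hh y hy).fderiv_right (by simp)).clm_apply contDiffAt_const

theorem SmoothOff.congr {h h' : EuclideanSpace ℝ (Fin n) → ℝ} (hh : SmoothOff h)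
    (he : ∀ y, y ≠ 0 → h' y = h y) : SmoothOff h' := fun y hy =>
  (hh y hy).congr_of_eventuallyEq (by
    filter_upwards [isOpen_ne.mem_nhds hy] with z hz using he z hz)

theorem SmoothOff.add {h h' : EuclideanSpace ℝ (Fin n) → ℝ} (hh : SmoothOff h)
    (hh' : SmoothOff h') : SmoothOff fun y => h y + h' y := fun y hy => (hh y hy).add (hh' y hy)

theorem SmoothOff.sub {h h' : EuclideanSpace ℝ (Fin n) → ℝ} (hh : SmoothOff h)
    (hh' : SmoothOff h') : SmoothOff fun y => h y - h' y := fun y hy => (hh y hy).sub (hh' y hy)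

theorem SmoothOff.mul {h h' : EuclideanSpace ℝ (Fin n) → ℝ} (hh : SmoothOff h)
    (hh' : SmoothOff h') : SmoothOff fun y => h y * h' y := fun y hy => (hh y hy).mul (hh' y hy)

theorem SmoothOff.const (c : ℝ) : SmoothOff fun _ : EuclideanSpace ℝ (Fin n) => c :=
  fun _ _ => contDiffAt_const

theorem SmoothOff.sum {ι : Type*} {s : Finset ι} {h : ι → EuclideanSpace ℝ (Fin n) → ℝ}
    (hh : ∀ i, SmoothOff (h i)) : SmoothOff fun y => ∑ i ∈ s, h i y :=
  fun y hy => ContDiffAt.sum fun i _ => hh i y hy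

theorem SmoothOff.coord (k : Fin n) : SmoothOff fun y : EuclideanSpace ℝ (Fin n) => y k :=
  fun _ _ => (EuclideanSpace.proj k : EuclideanSpace ℝ (Fin n) →L[ℝ] ℝ).contDiff.contDiffAt

theorem pd_congr {h h' : EuclideanSpace ℝ (Fin n) → ℝ} (he : ∀ y, y ≠ 0 → h y = h' y) (i : Fin n)
    (y : EuclideanSpace ℝ (Fin n)) (hy : y ≠ 0) : pd i h y = pd i h' y := by
  have : h =ᶠ[𝓝 y] h' := by
    filter_upwards [isOpen_ne.mem_nhds hy] with z hz using he z hz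
  rw [pd, pd, this.fderiv_eq]

theorem pd_add {h h' : EuclideanSpace ℝ (Fin n) → ℝ} {y : EuclideanSpace ℝ (Fin n)}
    (hh : DifferentiableAt ℝ h y) (hh' : DifferentiableAt ℝ h' y) (i : Fin n) :
    pd i (fun z => h z + h' z) y = pd i h y + pd i h' y := by
  rw [pd, fderiv_fun_add hh hh']
  rfl

theorem pd_sub {h h' : EuclideanSpace ℝ (Fin n) → ℝ} {y : EuclideanSpace ℝ (Fin n)}
    (hh : DifferentiableAt ℝ h y) (hh' : DifferentiableAt ℝ h' y) (i : Fin n) :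
    pd i (fun z => h z - h' z) y = pd i h y - pd i h' y := by
  rw [pd, fderiv_fun_sub hh hh']
  rfl

theorem pd_mul {h h' : EuclideanSpace ℝ (Fin n) → ℝ} {y : EuclideanSpace ℝ (Fin n)}
    (hh : DifferentiableAt ℝ h y) (hh' : DifferentiableAt ℝ h' y) (i : Fin n) :
    pd i (fun z => h z * h' z) y = h y * pd i h' y + h' y * pd i h y := by
  rw [pd, fderiv_fun_mul hh hh']
  rfl

theorem pd_const_mul {h : EuclideanSpace ℝ (Fin n) → ℝ} {y : EuclideanSpace ℝ (Fin n)}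
    (hh : DifferentiableAt ℝ h y) (c : ℝ) (i : Fin n) :
    pd i (fun z => c * h z) y = c * pd i h y := by
  rw [pd, fderiv_const_mul hh]
  rfl

theorem pd_sum {ι : Type*} {s : Finset ι} {h : ι → EuclideanSpace ℝ (Fin n) → ℝ}
    {y : EuclideanSpace ℝ (Fin n)} (hh : ∀ l, DifferentiableAt ℝ (h l) y) (i : Fin n) :
    pd i (fun z => ∑ l ∈ s, h l z) y = ∑ l ∈ s, pd i (h l) y := by
  rw [pd, fderiv_fun_sum fun l _ => hh l]
  simp [pd]

theorem pd_clm (T : EuclideanSpace ℝ (Fin n) →L[ℝ] ℝ) (i : Fin n) (y : EuclideanSpace ℝ (Fin n)) :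
    pd i (fun z => T z) y = T (EuclideanSpace.single i 1) := by
  rw [pd, T.fderiv]

theorem eq_sum_single (v : EuclideanSpace ℝ (Fin n)) :
    v = ∑ i, v i • EuclideanSpace.single i (1 : ℝ) := by
  ext j
  simp [Finset.sum_apply, Pi.single_apply]

theorem clm_apply_eq_sum (T : EuclideanSpace ℝ (Fin n) →L[ℝ] ℝ) (v : EuclideanSpace ℝ (Fin n)) :
    T v = ∑ i, v i * T (EuclideanSpace.single i 1) := by
  conv_lhs => rw [eq_sum_single v]
  simp

theorem fderiv_apply_eq_sum (h : EuclideanSpace ℝ (Fin n) → ℝ) (y v : EuclideanSpace ℝ (Fin n)) :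
    fderiv ℝ h y v = ∑ i, v i * pd i h y :=
  clm_apply_eq_sum _ v

theorem pd_pd {h : EuclideanSpace ℝ (Fin n) → ℝ} (hh : SmoothOff h)
    {y : EuclideanSpace ℝ (Fin n)} (hy : y ≠ 0) (i j : Fin n) :
    pd i (pd j h) y = fderiv ℝ (fderiv ℝ h) y (EuclideanSpace.single i 1)
      (EuclideanSpace.single j 1) := by
  have h1 : DifferentiableAt ℝ (fderiv ℝ h) y :=
    ((hh y hy).fderiv_right (m := ∞) (by simp)).differentiableAt (by simp)
  have h2 := h1.hasFDerivAt.clm_apply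
    (hasFDerivAt_const (EuclideanSpace.single j (1 : ℝ)) y)
  have h3 : fderiv ℝ (pd j h) y = _ := h2.fderiv
  rw [pd, h3]
  simp

/-- The third partial derivative. -/
noncomputable def pd₃ (i j k : Fin n) (h : EuclideanSpace ℝ (Fin n) → ℝ) :
    EuclideanSpace ℝ (Fin n) → ℝ := pd k (pd j (pd i h))

theorem pd₃_congr {h h' : EuclideanSpace ℝ (Fin n) → ℝ} (he : ∀ y, y ≠ 0 → h y = h' y)
    (i j k : Fin n) (y : EuclideanSpace ℝ (Fin n)) (hy : y ≠ 0) :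
    pd₃ i j k h y = pd₃ i j k h' y :=
  pd_congr (pd_congr (pd_congr he i) j) k y hy

theorem pd₃_add {h h' : EuclideanSpace ℝ (Fin n) → ℝ} (hh : SmoothOff h) (hh' : SmoothOff h')
    (i j k : Fin n) (y : EuclideanSpace ℝ (Fin n)) (hy : y ≠ 0) :
    pd₃ i j k (fun z => h z + h' z) y = pd₃ i j k h y + pd₃ i j k h' y := by
  have h1 := pd_congr (pd_congr (fun y hy => pd_add (hh.differentiableAt hy)
    (hh'.differentiableAt hy) i) j) k y hy
  have h2 := pd_congr (fun y hy => pd_add ((hh.pd i).differentiableAt hy)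
    ((hh'.pd i).differentiableAt hy) j) k y hy
  exact h1.trans (h2.trans (pd_add (((hh.pd i).pd j).differentiableAt hy)
    (((hh'.pd i).pd j).differentiableAt hy) k))

theorem pd₃_sub {h h' : EuclideanSpace ℝ (Fin n) → ℝ} (hh : SmoothOff h) (hh' : SmoothOff h')
    (i j k : Fin n) (y : EuclideanSpace ℝ (Fin n)) (hy : y ≠ 0) :
    pd₃ i j k (fun z => h z - h' z) y = pd₃ i j k h y - pd₃ i j k h' y := by
  have h1 := pd_congr (pd_congr (fun y hy => pd_sub (hh.differentiableAt hy)
    (hh'.differentiableAt hy) i) j) k y hy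
  have h2 := pd_congr (fun y hy => pd_sub ((hh.pd i).differentiableAt hy)
    ((hh'.pd i).differentiableAt hy) j) k y hy
  exact h1.trans (h2.trans (pd_sub (((hh.pd i).pd j).differentiableAt hy)
    (((hh'.pd i).pd j).differentiableAt hy) k))

theorem pd_linearCombination {h : Fin n → EuclideanSpace ℝ (Fin n) → ℝ}
    (hh : ∀ l, SmoothOff (h l)) (c : Fin n → ℝ) (i : Fin n) (y : EuclideanSpace ℝ (Fin n))
    (hy : y ≠ 0) : pd i (fun z => ∑ l, c l * h l z) y = ∑ l, c l * pd i (h l) y := by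
  rw [pd_sum fun l => ((hh l).differentiableAt hy).const_mul (c l)]
  exact Finset.sum_congr rfl fun l _ => pd_const_mul ((hh l).differentiableAt hy) (c l) i

theorem pd₃_linearCombination {h : Fin n → EuclideanSpace ℝ (Fin n) → ℝ}
    (hh : ∀ l, SmoothOff (h l)) (c : Fin n → ℝ) (i j k : Fin n) (y : EuclideanSpace ℝ (Fin n))
    (hy : y ≠ 0) : pd₃ i j k (fun z => ∑ l, c l * h l z) y = ∑ l, c l * pd₃ i j k (h l) y := by
  have h1 := pd_congr (pd_congr (fun y hy => pd_linearCombination hh c i y hy) j) k y hy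
  have h2 := pd_congr (fun y hy => pd_linearCombination (fun l => (hh l).pd i) c j y hy) k y hy
  exact h1.trans (h2.trans (pd_linearCombination (fun l => ((hh l).pd i).pd j) c k y hy))

theorem pd₃_sq_clm (T : EuclideanSpace ℝ (Fin n) →L[ℝ] ℝ) (i j k : Fin n)
    (y : EuclideanSpace ℝ (Fin n)) : pd₃ i j k (fun z => T z * T z) y = 0 := by
  have h1 : pd i (fun z => T z * T z) = fun z => 2 * T (EuclideanSpace.single i 1) * T z := by
    funext z
    rw [pd_mul T.differentiableAt T.differentiableAt, pd_clm]
    ring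
  have h2 : pd j (pd i (fun z => T z * T z)) = fun _ =>
      2 * T (EuclideanSpace.single i 1) * T (EuclideanSpace.single j 1) := by
    funext z
    rw [h1, pd_const_mul T.differentiableAt, pd_clm]
  rw [pd₃, h2, pd]
  simp

end PartialDerivatives

/-! ### Functions with vanishing third derivatives -/

/-- The second derivatives are locally constant on the punctured space, which is connected in
dimension at least two. So the Hessian is one constant form, and Euler's relations recover dQ and Q
from it. -/
theorem exists_quadratic_of_pd₃_eq_zero {n : ℕ} (hn : 2 ≤ n) {Q : EuclideanSpace ℝ (Fin n) → ℝ}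
    (hQ : SmoothOff Q) (hhom : ∀ (y : EuclideanSpace ℝ (Fin n)) (t : ℝ), 0 < t →
      Q (t • y) = t ^ 2 * Q y)
    (h3 : ∀ i j k y, y ≠ 0 → pd₃ i j k Q y = 0) :
    ∃ q : EuclideanSpace ℝ (Fin n) →L[ℝ] EuclideanSpace ℝ (Fin n) →L[ℝ] ℝ,
      (∀ v w, q v w = q w v) ∧ ∀ y, y ≠ 0 → fderiv ℝ Q y = q y ∧ 2 * Q y = q y y := by
  have hconn : IsPreconnected ({0}ᶜ : Set (EuclideanSpace ℝ (Fin n))) := by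
    refine (isConnected_compl_singleton_of_one_lt_rank ?_ 0).isPreconnected
    rw [← Module.finrank_eq_rank, finrank_euclideanSpace_fin]
    exact_mod_cast hn
  have hconst : ∀ i j y y', y ≠ 0 → y' ≠ 0 → pd j (pd i Q) y = pd j (pd i Q) y' := by
    intro i j y y' hy hy'
    refine isOpen_compl_singleton.is_const_of_fderiv_eq_zero (𝕜 := ℝ) hconn
      (fun z hz => (((hQ.pd i).pd j).differentiableAt hz).differentiableWithinAt)
      (fun z hz => ?_) hy hy'
    ext v
    rw [fderiv_apply_eq_sum]
    exact Finset.sum_eq_zero fun k _ => by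
      rw [show pd k (pd j (pd i Q)) z = 0 from h3 i j k z hz, mul_zero]
  obtain ⟨y₀, hy₀⟩ : ∃ y₀ : EuclideanSpace ℝ (Fin n), y₀ ≠ 0 :=
    ⟨EuclideanSpace.single ⟨0, by omega⟩ 1, by simp⟩
  have hhess : ∀ y, y ≠ 0 → fderiv ℝ (fderiv ℝ Q) y = fderiv ℝ (fderiv ℝ Q) y₀ := by
    intro y hy
    ext v w
    rw [eq_sum_single v, eq_sum_single w]
    simp only [map_sum, map_smul, sum_apply, smul_apply]
    simp only [← pd_pd hQ hy, ← pd_pd hQ hy₀, hconst _ _ y y₀ hy hy₀]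
  refine ⟨fderiv ℝ (fderiv ℝ Q) y₀, ?_, ?_⟩
  · exact fun v w => (hQ y₀ hy₀).isSymmSndFDerivAt (by simpa using ENat.LEInfty.out) v w
  · intro y hy
    have h1 : fderiv ℝ (fderiv ℝ Q) y y = fderiv ℝ Q y := by
      simpa using fderiv_apply_self_of_homogeneous (k := 1) (h := fderiv ℝ Q) (y := y)
        (fun t ht => by simpa using fderiv_smul_of_homogeneous (k := 1) hhom y ht)
        (((hQ y hy).fderiv_right (m := ∞) (by simp)).differentiableAt (by simp))
    have h2 : fderiv ℝ Q y y = 2 * Q y := by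
      simpa using fderiv_apply_self_of_homogeneous (k := 2) (hhom y) (hQ.differentiableAt hy)
    rw [← hhess y hy, h1, h2]
    exact ⟨rfl, rfl⟩

/-- `L` is, in induced coordinates, a Finsler metric at the point with coordinates `x`. -/
structure IsFinslerAt {n : ℕ} (L : EuclideanSpace ℝ (Fin n) → EuclideanSpace ℝ (Fin n) → ℝ)
    (x : EuclideanSpace ℝ (Fin n)) : Prop where
  smooth : ∀ y, y ≠ 0 → ContDiffAt ℝ ∞
    (fun z : EuclideanSpace ℝ (Fin n) × EuclideanSpace ℝ (Fin n) => L z.1 z.2) (x, y)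
  homogeneous : ∀ (y : EuclideanSpace ℝ (Fin n)) (t : ℝ), 0 < t → L x (t • y) = t * L x y
  posDef : ∀ y, y ≠ 0 → (metric L x y).PosDef

/-! ### Finsler metrics in induced coordinates -/

namespace IsFinslerAt

variable {n : ℕ} {L : EuclideanSpace ℝ (Fin n) → EuclideanSpace ℝ (Fin n) → ℝ}
  {x : EuclideanSpace ℝ (Fin n)}

theorem energy_smooth_uncurried (hL : IsFinslerAt L x) {y : EuclideanSpace ℝ (Fin n)}
    (hy : y ≠ 0) : ContDiffAt ℝ ∞
      (fun z : EuclideanSpace ℝ (Fin n) × EuclideanSpace ℝ (Fin n) => energy L z.1 z.2) (x, y) :=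
  contDiffAt_const.mul ((hL.smooth y hy).pow 2)

theorem energy_smoothOff (hL : IsFinslerAt L x) : SmoothOff (energy L x) := fun y hy =>
  (hL.energy_smooth_uncurried hy).comp y (contDiffAt_const.prodMk contDiffAt_id)

theorem energy_differentiableAt_left (hL : IsFinslerAt L x) {y : EuclideanSpace ℝ (Fin n)}
    (hy : y ≠ 0) : DifferentiableAt ℝ (fun x' => energy L x' y) x :=
  ((hL.energy_smooth_uncurried hy).comp x
    (contDiffAt_id.prodMk contDiffAt_const)).differentiableAt (by simp)

theorem pd_energy_left_smoothOff (hL : IsFinslerAt L x) (k : Fin n) :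
    SmoothOff fun y => pd k (fun x' => energy L x' y) x := by
  have h1 : SmoothOff fun y => fderiv ℝ
      (fun z : EuclideanSpace ℝ (Fin n) × EuclideanSpace ℝ (Fin n) => energy L z.1 z.2) (x, y)
      (EuclideanSpace.single k 1, 0) := fun y hy => by
    have h2 := (hL.energy_smooth_uncurried hy).fderiv_right (m := ∞) (by simp)
    exact (h2.comp y (contDiffAt_const.prodMk contDiffAt_id)).clm_apply contDiffAt_const
  refine h1.congr fun y hy => ?_
  have h3 := ((hL.energy_smooth_uncurried hy).differentiableAt (by simp)).hasFDerivAt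
  have h4 : HasFDerivAt
      (fun x' : EuclideanSpace ℝ (Fin n) => (x', y))
      ((ContinuousLinearMap.id ℝ _).prod 0) x :=
    (hasFDerivAt_id x).prodMk (hasFDerivAt_const y x)
  have h5 := h3.comp x h4
  have h6 : fderiv ℝ (fun x' => energy L x' y) x = _ := h5.fderiv
  rw [pd, h6]
  simp

theorem metric_smoothOff (hL : IsFinslerAt L x) (i j : Fin n) :
    SmoothOff fun y => metric L x y i j :=
  (hL.energy_smoothOff.pd j).pd i

theorem isUnit_det_metric (hL : IsFinslerAt L x) {y : EuclideanSpace ℝ (Fin n)} (hy : y ≠ 0) :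
    IsUnit (metric L x y).det :=
  (Matrix.isUnit_iff_isUnit_det _).1 (hL.posDef y hy).isUnit

theorem inv_metric_smoothOff (hL : IsFinslerAt L x) (i j : Fin n) :
    SmoothOff fun y => (metric L x y)⁻¹ i j := fun y hy =>
  contDiffAt_inv_entry (fun i j => hL.metric_smoothOff i j y hy)
    (hL.isUnit_det_metric hy).ne_zero i j

theorem metric_apply (hL : IsFinslerAt L x) {y : EuclideanSpace ℝ (Fin n)} (hy : y ≠ 0)
    (i j : Fin n) : metric L x y i j = fderiv ℝ (fderiv ℝ (energy L x)) y
      (EuclideanSpace.single i 1) (EuclideanSpace.single j 1) :=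
  pd_pd hL.energy_smoothOff hy i j

theorem hess_eq_sum (hL : IsFinslerAt L x) {y : EuclideanSpace ℝ (Fin n)} (hy : y ≠ 0)
    (v w : EuclideanSpace ℝ (Fin n)) : fderiv ℝ (fderiv ℝ (energy L x)) y v w
      = ∑ i, v i * ∑ j, metric L x y i j * w j := by
  conv_lhs => rw [eq_sum_single v]
  simp only [map_sum, map_smul, sum_apply, smul_apply, smul_eq_mul]
  refine Finset.sum_congr rfl fun i _ => ?_
  rw [clm_apply_eq_sum]
  congr 1
  exact Finset.sum_congr rfl fun j _ => by rw [hL.metric_apply hy, mul_comm]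

theorem isMinkowskiEnergy (hL : IsFinslerAt L x) : IsMinkowskiEnergy (energy L x) where
  smooth := hL.energy_smoothOff
  homogeneous y t ht := by
    simp only [energy, hL.homogeneous y t ht]
    ring
  hess_pos y hy v hv := by
    rw [hL.hess_eq_sum hy]
    have hv' : (v : Fin n → ℝ) ≠ 0 := fun h => hv (by ext i; exact congrFun h i)
    simpa [dotProduct, Matrix.mulVec] using (hL.posDef y hy).dotProduct_mulVec_pos hv'

theorem metric_symm (hL : IsFinslerAt L x) {y : EuclideanSpace ℝ (Fin n)} (hy : y ≠ 0)
    (i j : Fin n) : metric L x y i j = metric L x y j i := by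
  rw [hL.metric_apply hy, hL.metric_apply hy, hL.isMinkowskiEnergy.hess_symm hy]

theorem metric_smul (hL : IsFinslerAt L x) {y : EuclideanSpace ℝ (Fin n)} (hy : y ≠ 0) {t : ℝ}
    (ht : 0 < t) : metric L x (t • y) = metric L x y := by
  ext i j
  rw [hL.metric_apply hy, hL.metric_apply (smul_ne_zero ht.ne' hy),
    hL.isMinkowskiEnergy.hess_smul y ht]

theorem sum_metric_inv (hL : IsFinslerAt L x) {y : EuclideanSpace ℝ (Fin n)} (hy : y ≠ 0)
    (η : Fin n → ℝ) (j : Fin n) :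
    ∑ l, metric L x y j l * ∑ m, (metric L x y)⁻¹ l m * η m = η j := by
  have h1 : metric L x y * (metric L x y)⁻¹ = 1 :=
    Matrix.mul_nonsing_inv _ (hL.isUnit_det_metric hy)
  have h2 : (metric L x y).mulVec ((metric L x y)⁻¹.mulVec η) = η := by
    rw [Matrix.mulVec_mulVec, h1, Matrix.one_mulVec]
  exact congrFun h2 j

theorem eq_inv_sum (hL : IsFinslerAt L x) {y : EuclideanSpace ℝ (Fin n)} (hy : y ≠ 0)
    {v η : Fin n → ℝ} (h : ∀ j, ∑ l, metric L x y j l * v l = η j) (l : Fin n) :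
    v l = ∑ m, (metric L x y)⁻¹ l m * η m := by
  have h1 : (metric L x y)⁻¹ * metric L x y = 1 :=
    Matrix.nonsing_inv_mul _ (hL.isUnit_det_metric hy)
  have h2 : (metric L x y).mulVec v = η := funext h
  have h3 : (metric L x y)⁻¹.mulVec η = v := by
    rw [← h2, Matrix.mulVec_mulVec, h1, Matrix.one_mulVec]
  exact (congrFun h3 l).symm

theorem sum_metric_self (hL : IsFinslerAt L x) {y : EuclideanSpace ℝ (Fin n)} (hy : y ≠ 0)
    (j : Fin n) : ∑ l, metric L x y j l * y l = pd j (energy L x) y := by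
  have h1 := hL.hess_eq_sum hy (EuclideanSpace.single j 1) y
  rw [hL.isMinkowskiEnergy.hess_apply_self hy] at h1
  rw [pd, h1]
  simp

theorem sum_inv_metric_energy (hL : IsFinslerAt L x) {y : EuclideanSpace ℝ (Fin n)} (hy : y ≠ 0)
    (l : Fin n) : ∑ m, (metric L x y)⁻¹ l m * pd m (energy L x) y = y l :=
  (hL.eq_inv_sum hy (hL.sum_metric_self hy) l).symm

theorem grad_smoothOff (hL : IsFinslerAt L x) (a : EuclideanSpace ℝ (Fin n) → ℝ) (l : Fin n) :
    SmoothOff (grad L a l x) :=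
  SmoothOff.sum fun m => (hL.inv_metric_smoothOff l m).mul (SmoothOff.const _)

theorem spray_smoothOff (hL : IsFinslerAt L x) (l : Fin n) : SmoothOff (spray L l x) :=
  (SmoothOff.const _).mul (SmoothOff.sum fun m => (hL.inv_metric_smoothOff l m).mul
    ((SmoothOff.sum fun k => (SmoothOff.coord k).mul ((hL.pd_energy_left_smoothOff k).pd m)).sub
      (hL.pd_energy_left_smoothOff m)))

/-! #### The conformal change of the spray -/

section Conformal

variable {a : EuclideanSpace ℝ (Fin n) → ℝ}

theorem energy_conformal (L : EuclideanSpace ℝ (Fin n) → EuclideanSpace ℝ (Fin n) → ℝ)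
    (a : EuclideanSpace ℝ (Fin n) → ℝ) (x y : EuclideanSpace ℝ (Fin n)) :
    energy (fun x y => Real.exp (a x) * L x y) x y = Real.exp (a x) ^ 2 * energy L x y := by
  simp only [energy]
  ring

theorem metric_conformal (hL : IsFinslerAt L x) {y : EuclideanSpace ℝ (Fin n)} (hy : y ≠ 0) :
    metric (fun x y => Real.exp (a x) * L x y) x y = Real.exp (a x) ^ 2 • metric L x y := by
  ext i j
  have h0 : energy (fun x y => Real.exp (a x) * L x y) x
      = fun y => Real.exp (a x) ^ 2 * energy L x y := funext (energy_conformal L a x)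
  simp only [metric, Matrix.of_apply, Matrix.smul_apply, smul_eq_mul, h0]
  rw [pd_congr (fun y hy => pd_const_mul (hL.energy_smoothOff.differentiableAt hy) _ j) i y hy,
    pd_const_mul ((hL.energy_smoothOff.pd j).differentiableAt hy)]

theorem pd_energy_left_conformal (hL : IsFinslerAt L x) (ha : DifferentiableAt ℝ a x)
    {y : EuclideanSpace ℝ (Fin n)} (hy : y ≠ 0) (k : Fin n) :
    pd k (fun x' => energy (fun x y => Real.exp (a x) * L x y) x' y) x
      = Real.exp (a x) ^ 2 *
        (2 * pd k a x * energy L x y + pd k (fun x' => energy L x' y) x) := by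
  simp only [energy_conformal]
  have h1 : HasFDerivAt (fun x' => Real.exp (a x') ^ 2) _ x := (ha.hasFDerivAt.exp).pow 2
  rw [pd_mul h1.differentiableAt (hL.energy_differentiableAt_left hy)]
  have h2 : pd k (fun x' => Real.exp (a x') ^ 2) x = 2 * Real.exp (a x) ^ 2 * pd k a x := by
    rw [pd, h1.fderiv, pd]
    simp
    ring
  rw [h2]
  ring

/-- Position derivatives of e^(2a) E produce two extra terms in the bracket, 2(yᵏaₖ) ∂E/∂yᵐ and −2E
aₘ; raising the index turns them into multiples of y and of grad a, while the factors e^(2a) cancel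
against the inverse metric. -/
theorem spray_conformal (hL : IsFinslerAt L x) (ha : DifferentiableAt ℝ a x)
    {y : EuclideanSpace ℝ (Fin n)} (hy : y ≠ 0) (l : Fin n) :
    spray (fun x y => Real.exp (a x) * L x y) l x y
      = spray L l x y + ((∑ m, y m * pd m a x) * y l - energy L x y * grad L a l x y) := by
  have hc : Real.exp (a x) ^ 2 ≠ 0 := by positivity
  set c := Real.exp (a x) ^ 2 with hcdef
  have hinv : (metric (fun x y => Real.exp (a x) * L x y) x y)⁻¹ = c⁻¹ • (metric L x y)⁻¹ := by
    rw [hL.metric_conformal hy]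
    have : Invertible c := invertibleOfNonzero hc
    rw [Matrix.inv_smul _ _ (hL.isUnit_det_metric hy), invOf_eq_inv]
  have hmix : ∀ m k, pd m (fun y' => pd k
      (fun x' => energy (fun x y => Real.exp (a x) * L x y) x' y') x) y
      = c * (2 * pd k a x * pd m (energy L x) y
        + pd m (fun y' => pd k (fun x' => energy L x' y') x) y) := by
    intro m k
    have hd1 := hL.energy_smoothOff.differentiableAt hy
    have hd2 := (hL.pd_energy_left_smoothOff k).differentiableAt hy
    rw [pd_congr (fun y hy => hL.pd_energy_left_conformal ha hy k) m y hy,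
      pd_const_mul ((hd1.const_mul _).fun_add hd2), pd_add (hd1.const_mul _) hd2, pd_const_mul hd1]
  have hterm : ∀ m, (c⁻¹ • (metric L x y)⁻¹) l m *
      ((∑ k, y k * (c * (2 * pd k a x * pd m (energy L x) y
        + pd m (fun y' => pd k (fun x' => energy L x' y') x) y)))
        - c * (2 * pd m a x * energy L x y + pd m (fun x' => energy L x' y) x))
      = (metric L x y)⁻¹ l m * ((∑ k, y k * pd m (fun y' => pd k (fun x' => energy L x' y') x) y)
          - pd m (fun x' => energy L x' y) x)
        + (2 * (∑ k, y k * pd k a x) * ((metric L x y)⁻¹ l m * pd m (energy L x) y)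
          - 2 * energy L x y * ((metric L x y)⁻¹ l m * pd m a x)) := by
    intro m
    have hs : (∑ k, y k * (c * (2 * pd k a x * pd m (energy L x) y
        + pd m (fun y' => pd k (fun x' => energy L x' y') x) y)))
        = c * (2 * (∑ k, y k * pd k a x) * pd m (energy L x) y
          + ∑ k, y k * pd m (fun y' => pd k (fun x' => energy L x' y') x) y) := by
      rw [mul_add, Finset.mul_sum, Finset.mul_sum, Finset.sum_mul, Finset.mul_sum,
        ← Finset.sum_add_distrib]
      exact Finset.sum_congr rfl fun k _ => by ring
    rw [hs, Matrix.smul_apply, smul_eq_mul]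
    field_simp
    ring
  rw [spray, spray, hinv]
  simp only [hmix, hL.pd_energy_left_conformal ha hy, ← hcdef]
  simp only [hterm]
  rw [Finset.sum_add_distrib, Finset.sum_sub_distrib, ← Finset.mul_sum, ← Finset.mul_sum,
    hL.sum_inv_metric_energy hy, grad]
  ring

/-- The squared length `|grad a|²` of the Finslerian gradient. -/
noncomputable def gradNormSq (L : EuclideanSpace ℝ (Fin n) → EuclideanSpace ℝ (Fin n) → ℝ)
    (a : EuclideanSpace ℝ (Fin n) → ℝ) (x y : EuclideanSpace ℝ (Fin n)) : ℝ :=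
  ∑ l, pd l a x * grad L a l x y

theorem gradNormSq_smoothOff (hL : IsFinslerAt L x) : SmoothOff (gradNormSq L a x) :=
  SmoothOff.sum fun l => (SmoothOff.const _).mul (hL.grad_smoothOff a l)

/-- Contracted with da, the change of the spray is da(y)² − E|grad a|²; its first term is a
quadratic polynomial in y, invisible to third derivatives. -/
theorem pd₃_energy_mul_gradNormSq (hL : IsFinslerAt L x) (ha : DifferentiableAt ℝ a x)
    (hinv : ∀ (y : EuclideanSpace ℝ (Fin n)), y ≠ 0 → ∀ i j k : Fin n,
      ∑ l, mixedCurvature (fun x y => Real.exp (a x) * L x y) l i j k x y * pd l a x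
        = ∑ l, mixedCurvature L l i j k x y * pd l a x)
    (i j k : Fin n) (y : EuclideanSpace ℝ (Fin n)) (hy : y ≠ 0) :
    pd₃ i j k (fun y => energy L x y * gradNormSq L a x y) y = 0 := by
  set L' := fun x y => Real.exp (a x) * L x y with hL'
  have hsm : ∀ l, SmoothOff (spray L l x) := hL.spray_smoothOff
  have hcorr : ∀ l, SmoothOff fun y : EuclideanSpace ℝ (Fin n) =>
      (∑ m, y m * pd m a x) * y l - energy L x y * grad L a l x y := fun l =>
    ((SmoothOff.sum fun m => (SmoothOff.coord m).mul (SmoothOff.const _)).mul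
      (SmoothOff.coord l)).sub (hL.energy_smoothOff.mul (hL.grad_smoothOff a l))
  have hsm' : ∀ l, SmoothOff (spray L' l x) := fun l =>
    ((hsm l).add (hcorr l)).congr fun y hy => hL.spray_conformal ha hy l
  have h1 : ∑ l, pd l a x * pd₃ i j k (spray L' l x) y
      = ∑ l, pd l a x * pd₃ i j k (spray L l x) y := by
    have := hinv y hy i j k
    simp only [mixedCurvature, neg_mul, Finset.sum_neg_distrib, neg_inj] at this
    simpa only [pd₃, mul_comm] using this
  rw [← pd₃_linearCombination hsm' _ i j k y hy, ← pd₃_linearCombination hsm _ i j k y hy] at h1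
  set T := fderiv ℝ a x with hT
  have hTy : ∀ y : EuclideanSpace ℝ (Fin n), ∑ m, y m * pd m a x = T y := fun y =>
    (fderiv_apply_eq_sum a x y).symm
  have hTsm : SmoothOff fun y => T y * T y := fun y _ => (T.contDiff.mul T.contDiff).contDiffAt
  have hQsm : SmoothOff fun y => energy L x y * gradNormSq L a x y :=
    hL.energy_smoothOff.mul hL.gradNormSq_smoothOff
  have hGsm : SmoothOff fun y => ∑ l, pd l a x * spray L l x y :=
    SmoothOff.sum fun l => (SmoothOff.const _).mul (hsm l)
  have h2 : ∀ y, y ≠ 0 → ∑ l, pd l a x * spray L' l x y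
      = ∑ l, pd l a x * spray L l x y
        + (T y * T y - energy L x y * gradNormSq L a x y) := by
    intro y hy
    simp only [hL', hL.spray_conformal ha hy, hTy]
    rw [gradNormSq, Finset.mul_sum]
    conv_rhs => rw [← hTy y, Finset.sum_mul]
    rw [← Finset.sum_sub_distrib, ← Finset.sum_add_distrib]
    refine Finset.sum_congr rfl fun l _ => ?_
    rw [hTy]
    ring
  rw [pd₃_congr h2 i j k y hy, pd₃_add hGsm (hTsm.sub hQsm) i j k y hy,
    pd₃_sub hTsm hQsm i j k y hy, pd₃_sq_clm] at h1
  linarith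

/-! ### The gradient of a and the gradient of its squared length -/

theorem sum_metric_grad (hL : IsFinslerAt L x) {y : EuclideanSpace ℝ (Fin n)} (hy : y ≠ 0)
    (j : Fin n) : ∑ l, metric L x y j l * grad L a l x y = pd j a x :=
  hL.sum_metric_inv hy (fun m => pd m a x) j

theorem hess_grad (hL : IsFinslerAt L x) {y : EuclideanSpace ℝ (Fin n)} (hy : y ≠ 0) :
    fderiv ℝ (fderiv ℝ (energy L x)) y (WithLp.toLp 2 fun l => grad L a l x y) = fderiv ℝ a x := by
  ext v
  rw [hL.isMinkowskiEnergy.hess_symm hy, hL.hess_eq_sum hy, fderiv_apply_eq_sum]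
  exact Finset.sum_congr rfl fun i _ => by rw [hL.sum_metric_grad hy]

theorem gradNormSq_smul (hL : IsFinslerAt L x) {y : EuclideanSpace ℝ (Fin n)} (hy : y ≠ 0) {t : ℝ}
    (ht : 0 < t) : gradNormSq L a x (t • y) = gradNormSq L a x y := by
  simp only [gradNormSq, grad, hL.metric_smul hy ht]

/-- The vector field `Xˢ Xˡₛ` is the gradient of the function `|X|²`. -/
theorem gradDerivGrad_eq (hL : IsFinslerAt L x) {y : EuclideanSpace ℝ (Fin n)} (hy : y ≠ 0)
    (l : Fin n) : gradDerivGrad L a x y l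
      = ∑ m, (metric L x y)⁻¹ l m * pd m (gradNormSq L a x) y := by
  refine hL.eq_inv_sum hy (fun j => ?_) l
  set X : Fin n → ℝ := fun l => grad L a l x y with hX
  -- This tensor, the third derivative of E in y, is totally symmetric. Hence both sides, with the
  -- index lowered, equal −C(j, X, X).
  set C : Fin n → Fin n → Fin n → ℝ := fun s j l => pd s (fun y => metric L x y j l) y with hC
  have hCsymm₁ : ∀ s j l, C s j l = C s l j := fun s j l =>
    pd_congr (fun y hy => hL.metric_symm hy j l) s y hy
  have hCsymm₂ : ∀ s j l, C s j l = C j s l := by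
    intro s j l
    have h1 := pd_pd (hL.energy_smoothOff.pd l) hy s j
    have h2 := pd_pd (hL.energy_smoothOff.pd l) hy j s
    have h3 := ((hL.energy_smoothOff.pd l) y hy).isSymmSndFDerivAt
      (by simpa using ENat.LEInfty.out) (EuclideanSpace.single s 1) (EuclideanSpace.single j 1)
    exact h1.trans (h3.trans h2.symm)
  have hdiff : ∀ s j, ∑ l, metric L x y j l * pd s (grad L a l x) y = -∑ l, X l * C s j l := by
    intro s j
    have h1 : pd s (fun y => ∑ l, metric L x y j l * grad L a l x y) y = 0 := by
      rw [pd_congr (fun y hy => hL.sum_metric_grad hy j) s y hy, pd]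
      simp
    rw [pd_sum fun l => ((hL.metric_smoothOff j l).mul
      (hL.grad_smoothOff a l)).differentiableAt hy] at h1
    have h2 : ∀ l, pd s (fun y => metric L x y j l * grad L a l x y) y
        = metric L x y j l * pd s (grad L a l x) y + X l * C s j l := fun l =>
      pd_mul ((hL.metric_smoothOff j l).differentiableAt hy)
        ((hL.grad_smoothOff a l).differentiableAt hy) s
    simp only [h2, Finset.sum_add_distrib] at h1
    linarith
  have hleft : ∑ l, metric L x y j l * gradDerivGrad L a x y l
      = -∑ s, X s * ∑ l, X l * C s j l := by
    simp only [gradDerivGrad, Finset.mul_sum]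
    rw [Finset.sum_comm, ← Finset.sum_neg_distrib]
    refine Finset.sum_congr rfl fun s _ => ?_
    have h1 := hdiff s j
    rw [← Finset.mul_sum, ← mul_neg, ← h1, Finset.mul_sum]
    exact Finset.sum_congr rfl fun l _ => by ring
  have hright : pd j (gradNormSq L a x) y = -∑ s, X s * ∑ l, X l * C s j l := by
    have h1 : pd j (gradNormSq L a x) y = ∑ l, pd l a x * pd j (grad L a l x) y :=
      pd_linearCombination (fun l => hL.grad_smoothOff a l) _ j y hy
    have h2 : ∀ l, pd l a x = ∑ s, metric L x y s l * X s := fun l => by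
      rw [← hL.sum_metric_grad hy l]
      exact Finset.sum_congr rfl fun s _ => by rw [hL.metric_symm hy]
    rw [h1]
    simp only [h2, Finset.sum_mul]
    rw [Finset.sum_comm, ← Finset.sum_neg_distrib]
    refine Finset.sum_congr rfl fun s _ => ?_
    have h3 := hdiff j s
    simp only [hCsymm₂ s j]
    rw [← mul_neg, ← h3, Finset.mul_sum]
    exact Finset.sum_congr rfl fun l _ => by ring
  rw [hleft, hright]

theorem projGrad_eq (hL : IsFinslerAt L x) {y : EuclideanSpace ℝ (Fin n)} (hy : y ≠ 0)
    (l : Fin n) : projGrad L a x y l = ∑ m, (metric L x y)⁻¹ l m *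
      (pd m a x - (∑ m, y m * pd m a x) / (2 * energy L x y) * pd m (energy L x) y) := by
  simp only [mul_sub, Finset.sum_sub_distrib]
  rw [projGrad, grad]
  congr 1
  rw [← hL.sum_inv_metric_energy hy l, Finset.mul_sum]
  exact Finset.sum_congr rfl fun m _ => by ring

/-- If the mixed curvature contracted with `da` is invariant under the conformal change by
`exp a`, then the gradient of `|grad a|²` is a multiple of the projected gradient of `a`. -/
theorem exists_gradDerivGrad_eq_smul (hL : IsFinslerAt L x) (hn : 2 ≤ n)
    (ha : DifferentiableAt ℝ a x) (ha0 : fderiv ℝ a x ≠ 0)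
    (hinv : ∀ (y : EuclideanSpace ℝ (Fin n)), y ≠ 0 → ∀ i j k : Fin n,
      ∑ l, mixedCurvature (fun x y => Real.exp (a x) * L x y) l i j k x y * pd l a x
        = ∑ l, mixedCurvature L l i j k x y * pd l a x)
    {y : EuclideanSpace ℝ (Fin n)} (hy : y ≠ 0) :
    ∃ c : ℝ, gradDerivGrad L a x y = c • projGrad L a x y := by
  have hE := hL.isMinkowskiEnergy
  set Q : EuclideanSpace ℝ (Fin n) → ℝ := fun y => energy L x y * gradNormSq L a x y with hQ
  have hQsm : SmoothOff Q := hL.energy_smoothOff.mul hL.gradNormSq_smoothOff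
  -- The homogeneity of Q is also needed at the origin, where only E(0) = 4E(0) is available.
  have hE0 : energy L x 0 = 0 := by
    have := hE.homogeneous 0 2 two_pos
    rw [smul_zero] at this
    linarith
  have hQhom : ∀ (y : EuclideanSpace ℝ (Fin n)) (t : ℝ), 0 < t → Q (t • y) = t ^ 2 * Q y := by
    intro y t ht
    rcases eq_or_ne y 0 with rfl | hy
    · simp [hQ, hE0]
    · simp only [hQ, hE.homogeneous y t ht, hL.gradNormSq_smul hy ht]
      ring
  obtain ⟨q, hqs, hq⟩ := exists_quadratic_of_pd₃_eq_zero hn hQsm hQhom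
    (hL.pd₃_energy_mul_gradNormSq ha hinv)
  have hgrad : HasQuadraticGradient (energy L x) (fderiv ℝ a x) q := by
    refine ⟨hE, ha0, hqs, fun y hy X hX => ?_⟩
    have h1 : X = WithLp.toLp 2 fun l => grad L a l x y := by
      apply (hE.hessEquiv hy).injective
      have h2 := hX.trans (hL.hess_grad (a := a) hy).symm
      rw [← hE.coe_hessEquiv hy] at h2
      exact h2
    rw [← (hq y hy).2, h1, fderiv_apply_eq_sum]
    simp only [hQ, gradNormSq, mul_assoc]
    congr 2
    exact Finset.sum_congr rfl fun l _ => mul_comm _ _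
  obtain ⟨p, r, hpr⟩ := hgrad.exists_eq_combination hy
  have hEy := hE.pos hy
  set f := gradNormSq L a x with hf
  set u := ∑ m, y m * pd m a x with hu
  -- The squared length of the gradient is homogeneous of degree 0 in y; this relation eliminates
  -- the coefficient of dE in favour of p.
  have hfy : fderiv ℝ f y y = 0 := by
    simpa using fderiv_apply_self_of_homogeneous (k := 0) (h := f) (y := y)
      (fun t ht => by simpa using hL.gradNormSq_smul hy ht)
      (hL.gradNormSq_smoothOff.differentiableAt hy)
  have hdf : ∀ m, energy L x y * pd m f y
      = p * pd m a x + (r - f y) * pd m (energy L x) y := by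
    intro m
    have h1 : pd m Q y = _ := pd_mul (hL.energy_smoothOff.differentiableAt hy)
      (hL.gradNormSq_smoothOff.differentiableAt hy) m
    have h2 : pd m Q y = p * pd m a x + r * pd m (energy L x) y := by
      rw [pd, (hq y hy).1, hpr]
      rfl
    rw [h2] at h1
    linarith
  have huE : p * u + (r - f y) * (2 * energy L x y) = 0 := by
    have h1 : ∑ m, y m * (energy L x y * pd m f y) = 0 := by
      rw [← mul_zero (energy L x y), ← hfy, fderiv_apply_eq_sum, Finset.mul_sum]
      exact Finset.sum_congr rfl fun m _ => by ring
    simp only [hdf] at h1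
    rw [← hE.fderiv_apply_self hy, fderiv_apply_eq_sum, hu, Finset.mul_sum, Finset.mul_sum,
      ← Finset.sum_add_distrib, ← h1]
    exact Finset.sum_congr rfl fun m _ => by ring
  refine ⟨p / energy L x y, funext fun l => ?_⟩
  rw [hL.gradDerivGrad_eq hy, Pi.smul_apply, hL.projGrad_eq hy, smul_eq_mul, Finset.mul_sum]
  refine Finset.sum_congr rfl fun m _ => ?_
  have h1 : pd m f y = p / energy L x y *
      (pd m a x - u / (2 * energy L x y) * pd m (energy L x) y) := by
    have h2 : r - f y = -(p * u) / (2 * energy L x y) := by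
      field_simp
      linarith
    have h3 := hdf m
    rw [h2] at h3
    field_simp at h3 ⊢
    linarith
  rw [h1]
  ring

end Conformal

end IsFinslerAt

/-! ### Passage from the manifold to coordinates -/

section Manifold

variable {n : ℕ} {M : Type*} [TopologicalSpace M]
  [ChartedSpace (EuclideanSpace ℝ (Fin n)) M]
  {e : OpenPartialHomeomorph M (EuclideanSpace ℝ (Fin n))}

theorem mdifferentiable_of_mem_maximalAtlas
    (he : e ∈ IsManifold.maximalAtlas (𝓡 n) ∞ M) : e.MDifferentiable (𝓡 n) (𝓡 n) :=
  ⟨(contMDiffOn_of_mem_maximalAtlas he).mdifferentiableOn (by simp),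
    (contMDiffOn_symm_of_mem_maximalAtlas he).mdifferentiableOn (by simp)⟩

theorem mfderiv_symm_ne_zero (he : e ∈ IsManifold.maximalAtlas (𝓡 n) ∞ M)
    {x : EuclideanSpace ℝ (Fin n)} (hx : x ∈ e.target) {y : EuclideanSpace ℝ (Fin n)}
    (hy : y ≠ 0) : mfderiv (𝓡 n) (𝓡 n) e.symm x y ≠ 0 := by
  intro h
  apply hy
  have hinj := ((mdifferentiable_of_mem_maximalAtlas he).symm.mfderiv_bijective hx).injective
  exact hinj (h.trans (map_zero _).symm)

theorem differentiableAt_comp_symm {α : M → ℝ} (hα : ContMDiff (𝓡 n) 𝓘(ℝ, ℝ) ∞ α)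
    (he : e ∈ IsManifold.maximalAtlas (𝓡 n) ∞ M) {x : EuclideanSpace ℝ (Fin n)}
    (hx : x ∈ e.target) : DifferentiableAt ℝ (α ∘ e.symm) x := by
  have h1 : ContMDiffAt (𝓡 n) 𝓘(ℝ, ℝ) ∞ (α ∘ e.symm) x :=
    hα.contMDiffAt.comp x (contMDiffAt_symm_of_mem_maximalAtlas he hx)
  exact (h1.mdifferentiableAt (by simp)).differentiableAt

theorem fderiv_comp_symm_ne_zero {α : M → ℝ} (hα : ContMDiff (𝓡 n) 𝓘(ℝ, ℝ) ∞ α)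
    (he : e ∈ IsManifold.maximalAtlas (𝓡 n) ∞ M) {p : M} (hpe : p ∈ e.source)
    (hp : mfderiv (𝓡 n) 𝓘(ℝ, ℝ) α p ≠ 0) : fderiv ℝ (α ∘ e.symm) (e p) ≠ 0 := by
  intro h0
  apply hp
  have hd := differentiableAt_comp_symm hα he (e.map_source hpe)
  have h1 : α =ᶠ[𝓝 p] (α ∘ e.symm) ∘ e := by
    filter_upwards [e.open_source.mem_nhds hpe] with r hr
    simp [e.left_inv hr]
  have h2 : MDifferentiableAt (𝓡 n) (𝓡 n) e p :=
    (mdifferentiable_of_mem_maximalAtlas he).mdifferentiableAt hpe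
  rw [h1.mfderiv_eq, mfderiv_comp p hd.mdifferentiableAt h2, mfderiv_eq_fderiv, h0]
  rfl

variable [IsManifold (𝓡 n) ∞ M]

/-- The map is the tangent map of the inverse chart, read through the trivialization of the tangent
bundle of ℝⁿ; on the open target, derivatives within the target are ordinary ones. -/
theorem contMDiffAt_tangent_symm (he : e ∈ IsManifold.maximalAtlas (𝓡 n) ∞ M)
    {x : EuclideanSpace ℝ (Fin n)} (hx : x ∈ e.target) (y : EuclideanSpace ℝ (Fin n)) :
    ContMDiffAt 𝓘(ℝ, EuclideanSpace ℝ (Fin n) × EuclideanSpace ℝ (Fin n)) (𝓡 n).tangent ∞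
      (fun z : EuclideanSpace ℝ (Fin n) × EuclideanSpace ℝ (Fin n) =>
        (⟨e.symm z.1, mfderiv (𝓡 n) (𝓡 n) e.symm z.1 z.2⟩ : TangentBundle (𝓡 n) M)) (x, y) := by
  have h1 := (contMDiffOn_symm_of_mem_maximalAtlas he).contMDiffOn_tangentMapWithin
    (m := ∞) (by simp) e.open_target.uniqueMDiffOn
  have h2 : ContMDiffAt (𝓡 n).tangent (𝓡 n).tangent ∞
      (tangentMapWithin (𝓡 n) (𝓡 n) e.symm e.target)
      (⟨x, y⟩ : TangentBundle (𝓡 n) (EuclideanSpace ℝ (Fin n))) := by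
    refine h1.contMDiffAt ?_
    have : Continuous (Bundle.TotalSpace.proj :
      TangentBundle (𝓡 n) (EuclideanSpace ℝ (Fin n)) → EuclideanSpace ℝ (Fin n)) :=
      FiberBundle.continuous_proj _ _
    exact (e.open_target.preimage this).mem_nhds hx
  have h3 : ContMDiffAt 𝓘(ℝ, EuclideanSpace ℝ (Fin n) × EuclideanSpace ℝ (Fin n)) (𝓡 n).tangent ∞
      (fun z : EuclideanSpace ℝ (Fin n) × EuclideanSpace ℝ (Fin n) =>
        (⟨z.1, z.2⟩ : TangentBundle (𝓡 n) (EuclideanSpace ℝ (Fin n)))) (x, y) := by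
    rw [modelWithCornersSelf_prod]
    exact (contMDiff_tangentBundleModelSpaceHomeomorph_symm (I := 𝓡 n) (n := ∞)).contMDiffAt
  refine (h2.comp (x, y) h3).congr_of_eventuallyEq ?_
  filter_upwards [(e.open_target.preimage continuous_fst).mem_nhds hx] with z hz
  simp only [Function.comp_apply, tangentMapWithin]
  rw [mfderivWithin_of_isOpen e.open_target hz]

theorem IsFinslerMetric.isFinslerAt {F : TangentBundle (𝓡 n) M → ℝ} (hF : IsFinslerMetric F)
    (he : e ∈ IsManifold.maximalAtlas (𝓡 n) ∞ M) {x : EuclideanSpace ℝ (Fin n)}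
    (hx : x ∈ e.target) : IsFinslerAt (inChart F e) x where
  smooth y hy := by
    rw [← contMDiffAt_iff_contDiffAt]
    have h1 := contMDiffAt_tangent_symm he hx y
    have h2 := hF.smooth ⟨e.symm x, mfderiv (𝓡 n) (𝓡 n) e.symm x y⟩
      (mfderiv_symm_ne_zero he hx hy)
    have hev : ∀ᶠ z in 𝓝 (x, y), (⟨e.symm z.1, mfderiv (𝓡 n) (𝓡 n) e.symm z.1 z.2⟩ :
        TangentBundle (𝓡 n) M) ∈ {v : TangentBundle (𝓡 n) M | v.2 ≠ 0} := by
      filter_upwards [(e.open_target.preimage continuous_fst).mem_nhds hx,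
        (isOpen_ne.preimage continuous_snd).mem_nhds hy] with z hz hz'
      exact mfderiv_symm_ne_zero he hz hz'
    have h3 := ContMDiffWithinAt.comp (x, y) h2 (h1.contMDiffWithinAt
      (s := {z | (⟨e.symm z.1, mfderiv (𝓡 n) (𝓡 n) e.symm z.1 z.2⟩ :
        TangentBundle (𝓡 n) M) ∈ {v : TangentBundle (𝓡 n) M | v.2 ≠ 0}})) (fun z hz => hz)
    exact h3.contMDiffAt hev
  homogeneous y t ht := by
    have h1 : mfderiv (𝓡 n) (𝓡 n) e.symm x (t • y) = t • mfderiv (𝓡 n) (𝓡 n) e.symm x y :=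
      (mfderiv (𝓡 n) (𝓡 n) e.symm x).map_smul t y
    simp only [inChart, h1]
    exact hF.homogeneous _ _ t ht
  posDef y hy := hF.posDef e he x hx y hy

end Manifold

/-! ### Gram determinant of proportional vectors -/

theorem inner2_smul_right {m : ℕ} (g : Matrix (Fin m) (Fin m) ℝ) (a b : Fin m → ℝ) (c : ℝ) :
    inner2 g a (c • b) = c * inner2 g a b := by
  simp only [inner2, Finset.mul_sum, Pi.smul_apply, smul_eq_mul]
  exact Finset.sum_congr rfl fun i _ => Finset.sum_congr rfl fun j _ => by ring

theorem inner2_smul_left {m : ℕ} (g : Matrix (Fin m) (Fin m) ℝ) (a b : Fin m → ℝ) (c : ℝ) :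
    inner2 g (c • a) b = c * inner2 g a b := by
  simp only [inner2, Finset.mul_sum, Pi.smul_apply, smul_eq_mul]
  exact Finset.sum_congr rfl fun i _ => Finset.sum_congr rfl fun j _ => by ring

theorem gramDet_smul_self {m : ℕ} (g : Matrix (Fin m) (Fin m) ℝ) (a : Fin m → ℝ) (c : ℝ) :
    gramDet g a (c • a) = 0 := by
  simp only [gramDet, Matrix.det_fin_two_of, inner2_smul_left, inner2_smul_right]
  ring

theorem not_linearIndependent_smul_self {m : ℕ} (a : Fin m → ℝ) (c : ℝ) :
    ¬ LinearIndependent ℝ ![a, c • a] := by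
  rw [LinearIndependent.pair_iff]
  intro h
  have := (h c (-1) (by module)).2
  norm_num at this

end FinslerConformal

/-- The argument is global on the tangent space: the regularity of the energy at the two vectors
whose Legendre transforms are `±dα` replaces the curvature hypothesis, which is not used. -/
theorem theorem1 {n : ℕ} (hn : 3 ≤ n) {M : Type*} [TopologicalSpace M]
    [ChartedSpace (EuclideanSpace ℝ (Fin n)) M] [IsManifold (𝓡 n) ∞ M]
    (F : TangentBundle (𝓡 n) M → ℝ) (hF : IsFinslerMetric F)
    (α : M → ℝ) (hα : ContMDiff (𝓡 n) 𝓘(ℝ, ℝ) ∞ α)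
    (p : M) (hp : mfderiv (𝓡 n) 𝓘(ℝ, ℝ) α p ≠ 0)
    (e : OpenPartialHomeomorph M (EuclideanSpace ℝ (Fin n)))
    (he : e ∈ IsManifold.maximalAtlas (𝓡 n) ∞ M) (hpe : p ∈ e.source)
    (hcurv : IndicatrixPosCurved (inChart F e) (e p))
    (hinv : ∀ (y : EuclideanSpace ℝ (Fin n)), y ≠ 0 → ∀ i j k : Fin n,
      ∑ l, mixedCurvature (inChart (conformalChange α F) e) l i j k (e p) y
          * pd l (α ∘ e.symm) (e p)
        = ∑ l, mixedCurvature (inChart F e) l i j k (e p) y * pd l (α ∘ e.symm) (e p)) :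
    ∀ y : EuclideanSpace ℝ (Fin n), y ≠ 0 →
      gramDet (metric (inChart F e) (e p) y)
          (projGrad (inChart F e) (α ∘ e.symm) (e p) y)
          (gradDerivGrad (inChart F e) (α ∘ e.symm) (e p) y) = 0 ∧
      ¬ LinearIndependent ℝ
          ![projGrad (inChart F e) (α ∘ e.symm) (e p) y,
            gradDerivGrad (inChart F e) (α ∘ e.symm) (e p) y] := by
  intro y hy
  have hx : e p ∈ e.target := e.map_source hpe
  -- `hinv` fits as it stands: the coordinate expression of the conformally changed metric unfolds
  -- to exp(α ∘ e⁻¹) times that of F.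
  obtain ⟨c, hc⟩ := (hF.isFinslerAt he hx).exists_gradDerivGrad_eq_smul (by omega)
    (differentiableAt_comp_symm hα he hx) (fderiv_comp_symm_ne_zero hα he hpe hp) hinv hy
  rw [hc]
  exact ⟨gramDet_smul_self _ _ _, not_linearIndependent_smul_self _ _⟩
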